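/- All graphs are finite, undirected, without loops or multiple edges, and have at least one vertex. For $k \ge 1$ let $\mathsf{C}_k$ be the $k$-variable fragment of first-order logic with counting quantifiers over graphs: formulas are built from a fixed set of $k$ variables (which may be requantified) using equality, adjacency, Boolean connectives, the first-order quantifiers $\exists, \forall$, and the counting quantifiers $\exists^{\ge j} x\,\varphi$ ("at least $j$ distinct vertices $x$ satisfy $\varphi$"); over vertex-colored graphs there is also an atomic formula "$x$ has color $c$" for each color $c$. A graph $G$ is defined in $\mathsf{C}_k$ if there is a sentence $\varphi \in \mathsf{C}_k$ such that for every graph $H$, $H \models \varphi$ if and only if $H \cong G$; for vertex-colored graphs with colors in a set $C$, $H$ ranges over all vertex-colored graphs with colors in $C$, and isomorphisms preserve colors. There is a function $k\colon \mathbb{N} \to \mathbb{N}$ with $k(n) = \frac{n}{4} + o(n)$ as $n \to \infty$ such that, for every $n \ge 1$, every $n$-vertex graph can be defined in $\mathsf{C}_{k(n)}$, and every $n$-vertex vertex-colored graph, with colors from an arbitrary set $C$, can be defined in $\mathsf{C}_{k(n)}$ (over graphs colored by $C$). The function $k$ depends neither on the graph nor on $C$ or the coloring. -/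

import Mathlib

open scoped Asymptotics

universe u v w

/-- Formulas of first-order logic with counting quantifiers over graphs whose vertices may carry
colors from `C`, using only the `k` variables `x i`, `i : Fin k` (which may be requantified).
The other connectives and quantifiers of first-order logic are the usual abbreviations.
For uncolored graphs, `C` is the empty type, so that there are no color atoms. -/
inductive CFormula (C : Type w) (k : ℕ) : Type w
  /-- the false formula -/
  | falsum : CFormula C k
  /-- `x i = x j` -/
  | equal (i j : Fin k) : CFormula C k
  /-- `x i` and `x j` are adjacent -/
  | adj (i j : Fin k) : CFormula C k
  /-- `x i` has color `c` -/
  | color (c : C) (i : Fin k) : CFormula C k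
  /-- implication -/
  | imp (φ ψ : CFormula C k) : CFormula C k
  /-- the universal quantifier `∀ x i, φ` -/
  | all (i : Fin k) (φ : CFormula C k) : CFormula C k
  /-- the counting quantifier: there are at least `m` distinct values of `x i` satisfying `φ` -/
  | atLeast (m : ℕ) (i : Fin k) (φ : CFormula C k) : CFormula C k

namespace CFormula

/-- The free variables of a formula. -/
def freeVars {C : Type w} {k : ℕ} : CFormula C k → Finset (Fin k)
  | falsum => ∅
  | equal i j => {i, j}
  | adj i j => {i, j}
  | color _ i => {i}
  | imp φ ψ => φ.freeVars ∪ ψ.freeVars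
  | all i φ => φ.freeVars.erase i
  | atLeast _ i φ => φ.freeVars.erase i

/-- A sentence is a formula without free variables. -/
def IsSentence {C : Type w} {k : ℕ} (φ : CFormula C k) : Prop :=
  φ.freeVars = ∅

/-- Truth of a formula in the graph `G`, where `P c` is the set of vertices of color `c`, under
the assignment `a` of vertices to the variables. -/
def Realize {C : Type w} {k : ℕ} {V : Type v} (G : SimpleGraph V) (P : C → Set V) :
    CFormula C k → (Fin k → V) → Prop
  | falsum, _ => False
  | equal i j, a => a i = a j
  | adj i j, a => G.Adj (a i) (a j)
  | color c i, a => a i ∈ P c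
  | imp φ ψ, a => φ.Realize G P a → ψ.Realize G P a
  | all i φ, a => ∀ x : V, φ.Realize G P (Function.update a i x)
  | atLeast m i φ, a =>
      ∃ s : Finset V, m ≤ s.card ∧ ∀ x ∈ s, φ.Realize G P (Function.update a i x)

/-- `G ⊨ φ`, for an uncolored graph `G` and a sentence `φ` (whose truth in a nonempty graph does
not depend on the assignment). -/
def Models {k : ℕ} {V : Type v} (G : SimpleGraph V) (φ : CFormula Empty k) : Prop :=
  ∀ a : Fin k → V, φ.Realize G (fun c => c.elim) a

/-- `(G, χ) ⊨ φ`, for a vertex-colored graph `(G, χ)` and a sentence `φ`. -/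
def ModelsColored {C : Type w} {k : ℕ} {V : Type v} (G : SimpleGraph V) (χ : V → C)
    (φ : CFormula C k) : Prop :=
  ∀ a : Fin k → V, φ.Realize G (fun c => {x | χ x = c}) a

end CFormula

/-- The graph `G` can be defined in the `k`-variable fragment of counting logic: some sentence of
this fragment holds in exactly those (finite, nonempty) graphs that are isomorphic to `G`. -/
def DefinableInC (k : ℕ) {V : Type u} (G : SimpleGraph V) : Prop :=
  ∃ φ : CFormula Empty k, φ.IsSentence ∧
    ∀ (W : Type v) [Finite W] [Nonempty W] (H : SimpleGraph W),
      CFormula.Models H φ ↔ Nonempty (H ≃g G)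

/-- The vertex-colored graph `(G, χ)` with colors in `C` can be defined in the `k`-variable
fragment of counting logic: some sentence of this fragment holds in exactly those (finite,
nonempty) vertex-colored graphs `(H, η)` with colors in `C` that are isomorphic to `(G, χ)`. -/
def DefinableInCColored (k : ℕ) {C : Type w} {V : Type u} (G : SimpleGraph V) (χ : V → C) :
    Prop :=
  ∃ φ : CFormula C k, φ.IsSentence ∧
    ∀ (W : Type v) [Finite W] [Nonempty W] (H : SimpleGraph W) (η : W → C),
      CFormula.ModelsColored H η φ ↔ ∃ e : H ≃g G, ∀ x : W, χ (e x) = η x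

/-! It suffices that a graph agreeing with `G` on all `k`-variable sentences is isomorphic to `G`: a
defining sentence then fixes the order `n` and refutes finitely many structures on `Fin n`.
Agreement on sentences is used as a strategy in the bijective pebble game.

The placed pebbles partition the vertices into types. Give each part the potential `L + 3 * min size
L`. The total is at most `n * (L + 3)`, so at most `n * (L + 3) / (4 * L)` pebbles can gain `4 * L`
each, about `n / 4` for large `L` (`PebbledGraph.exists_terminal`).

Once no pebble gains that much, an extra pebble creates at most 3 new parts and never leaves two
parts of size at least `L` in one old part. Call a pair exceptional if its type covers at most half
of the second endpoint's fiber. Then each vertex has at most `18 * L` exceptional partners, and each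
fiber is linked by exceptional pairs to at most two others, so the linked fibers form paths and
cycles. A component of the graph of exceptional pairs meets each fiber in boundedly many vertices
(`Terminal.ncard_comp_inter_fiber_le`). It can be explored fiber by fiber along its path or cycle
with pebbles on the frontier only, so vertices of the same type have isomorphic components
(`Terminal.exists_map`). Counting matches up the components, and pairs between different components
are unexceptional, hence determined by the types of their endpoints (`Terminal.exists_equiv`). The
extra pebbles depend on `L` alone, and optimizing `L` for each `n` gives `n / 4 + o(n)`. -/

namespace CFormula

/-! ### Theories of assignments and the bijective pebble game -/

section Theory

variable {C : Type w} {k : ℕ} {V : Type u} {W : Type v}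

/-- The formulas that hold under an assignment. -/
def theory (G : SimpleGraph V) (P : C → Set V) (a : Fin k → V) : Set (CFormula C k) :=
  {φ | φ.Realize G P a}

/-- Negation. -/
def neg (φ : CFormula C k) : CFormula C k := imp φ falsum

/-- Finite conjunctions. -/
def conj : List (CFormula C k) → CFormula C k
  | [] => neg falsum
  | φ :: l => neg (imp φ (neg (conj l)))

/-- Existential quantification over a list of variables. -/
def exs : List (Fin k) → CFormula C k → CFormula C k
  | [], φ => φ
  | i :: l, φ => neg (all i (neg (exs l φ)))

@[simp] lemma realize_neg (G : SimpleGraph V) (P : C → Set V) (φ : CFormula C k)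
    (a : Fin k → V) : φ.neg.Realize G P a ↔ ¬ φ.Realize G P a := Iff.rfl

@[simp] lemma realize_conj (G : SimpleGraph V) (P : C → Set V) (l : List (CFormula C k))
    (a : Fin k → V) : (conj l).Realize G P a ↔ ∀ φ ∈ l, φ.Realize G P a := by
  induction l with
  | nil => simp [conj, Realize]
  | cons φ l ih =>
    simp only [conj, realize_neg, Realize, ih, List.mem_cons, forall_eq_or_imp]
    tauto

lemma realize_exs (G : SimpleGraph V) (P : C → Set V) (l : List (Fin k)) (φ : CFormula C k)
    (a : Fin k → V) :
    (exs l φ).Realize G P a ↔ ∃ b, (∀ i, i ∉ l → b i = a i) ∧ φ.Realize G P b := by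
  induction l generalizing a with
  | nil =>
    simp only [exs, List.not_mem_nil, not_false_eq_true, forall_const]
    constructor
    · exact fun h => ⟨a, fun _ => rfl, h⟩
    · rintro ⟨b, hb, h⟩
      rwa [← funext hb]
  | cons j l ih =>
    simp only [exs, realize_neg, Realize, ih, not_forall, not_not]
    constructor
    · rintro ⟨x, b, hb, h⟩
      refine ⟨b, fun i hi => ?_, h⟩
      rw [List.mem_cons, not_or] at hi
      rw [hb i hi.2, Function.update_of_ne hi.1]
    · rintro ⟨b, hb, h⟩
      refine ⟨b j, b, fun i hi => ?_, h⟩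
      by_cases hij : i = j
      · subst hij; simp
      · rw [Function.update_of_ne hij, hb i (by simp [hij, hi])]

lemma freeVars_exs (l : List (Fin k)) (φ : CFormula C k) :
    (exs l φ).freeVars = φ.freeVars \ l.toFinset := by
  induction l with
  | nil => simp [exs]
  | cons j l ih =>
    ext i
    simp only [exs, neg, freeVars, ih, Finset.union_empty, Finset.mem_erase, Finset.mem_sdiff,
      List.toFinset_cons, Finset.mem_insert]
    tauto

lemma isSentence_exs (φ : CFormula C k) : (exs (List.finRange k) φ).IsSentence := by
  rw [IsSentence, freeVars_exs]
  ext i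
  simp

lemma isSentence_neg {φ : CFormula C k} (h : φ.IsSentence) : φ.neg.IsSentence := by
  simpa [IsSentence, neg, freeVars] using h

lemma isSentence_conj {l : List (CFormula C k)} (h : ∀ φ ∈ l, φ.IsSentence) :
    (conj l).IsSentence := by
  induction l with
  | nil => rfl
  | cons φ l ih =>
    have h1 : φ.freeVars = ∅ := h φ (by simp)
    have h2 : (conj l).freeVars = ∅ := ih fun ψ hψ => h ψ (by simp [hψ])
    simp [IsSentence, conj, neg, freeVars, h1, h2]

/-- A relation between assignments with the back-and-forth property of the bijective pebble game
preserves truth. -/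
lemma realize_iff_of_bisim {G : SimpleGraph V} {P : C → Set V} {H : SimpleGraph W} {Q : C → Set W}
    (R : (Fin k → V) → (Fin k → W) → Prop)
    (heq : ∀ a b, R a b → ∀ i j, a i = a j ↔ b i = b j)
    (hadj : ∀ a b, R a b → ∀ i j, G.Adj (a i) (a j) ↔ H.Adj (b i) (b j))
    (hcol : ∀ a b, R a b → ∀ i c, a i ∈ P c ↔ b i ∈ Q c)
    (hext : ∀ a b, R a b → ∀ i, ∃ f : V ≃ W, ∀ x,
      R (Function.update a i x) (Function.update b i (f x)))
    (φ : CFormula C k) {a : Fin k → V} {b : Fin k → W} (hab : R a b) :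
    φ.Realize G P a ↔ φ.Realize H Q b := by
  induction φ generalizing a b with
  | falsum => rfl
  | equal i j => exact heq a b hab i j
  | adj i j => exact hadj a b hab i j
  | color c i => exact hcol a b hab i c
  | imp φ ψ h1 h2 => simp only [Realize]; rw [h1 hab, h2 hab]
  | all i φ ih =>
    obtain ⟨f, hf⟩ := hext a b hab i
    simp only [Realize]
    rw [← f.forall_congr_right]
    exact forall_congr' fun x => ih (hf x)
  | atLeast m i φ ih =>
    obtain ⟨f, hf⟩ := hext a b hab i
    simp only [Realize]
    constructor
    · rintro ⟨s, hs, h⟩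
      refine ⟨s.map f.toEmbedding, by simpa using hs, fun y hy => ?_⟩
      obtain ⟨x, hx, rfl⟩ := Finset.mem_map.1 hy
      exact (ih (hf x)).1 (h x hx)
    · rintro ⟨s, hs, h⟩
      refine ⟨s.map f.symm.toEmbedding, by simpa using hs, fun y hy => ?_⟩
      obtain ⟨x, hx, rfl⟩ := Finset.mem_map.1 hy
      refine (ih (hf _)).2 ?_
      simpa using h x hx

lemma realize_iff_of_iso {G : SimpleGraph V} {P : C → Set V} {H : SimpleGraph W} {Q : C → Set W}
    (e : V ≃ W) (hadj : ∀ x y, G.Adj x y ↔ H.Adj (e x) (e y)) (hcol : ∀ c x, x ∈ P c ↔ e x ∈ Q c)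
    (φ : CFormula C k) (a : Fin k → V) : φ.Realize G P a ↔ φ.Realize H Q (e ∘ a) := by
  refine realize_iff_of_bisim (fun a b => b = e ∘ a) ?_ ?_ ?_ ?_ φ rfl
  · rintro a _ rfl i j; simp
  · rintro a _ rfl i j; exact hadj _ _
  · rintro a _ rfl i c; exact hcol _ _
  · rintro a _ rfl i
    exact ⟨e, fun x => (Function.comp_update e a i x).symm⟩

/-- Among finitely many theories, each one is isolated by a formula. -/
lemma exists_isolating {ι : Type*} [Finite ι] (t : ι → Set (CFormula C k))
    (hneg : ∀ i φ, neg φ ∈ t i ↔ φ ∉ t i) (hconj : ∀ i l, conj l ∈ t i ↔ ∀ φ ∈ l, φ ∈ t i)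
    (i : ι) : ∃ φ, ∀ j, φ ∈ t j ↔ t j = t i := by
  classical
  cases nonempty_fintype ι
  have key : ∀ j, ∃ φ, φ ∈ t i ∧ (φ ∈ t j → t j = t i) := by
    intro j
    by_cases h : t j = t i
    · exact ⟨conj [], by simp [hconj], fun _ => h⟩
    -- Theories are complete, so an inclusion between two of them is an equality.
    · by_contra! hcon
      refine h (Set.Subset.antisymm (fun φ hφ => ?_) fun φ hφ => (hcon φ hφ).1)
      by_contra hφi
      exact ((hneg j φ).1 (hcon _ ((hneg i φ).2 hφi)).1) hφ
  choose ψ h1 h2 using key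
  refine ⟨conj (Finset.univ.toList.map ψ), fun j => ⟨fun h => ?_, fun h => ?_⟩⟩
  · rw [hconj] at h
    exact h2 j (h _ (by simp))
  · rw [h, hconj]
    simpa using fun j => h1 j

/-- Functions whose fibers have the same sizes differ by a bijection. -/
lemma exists_equiv_of_ncard_eq {α β T : Type*} [Finite α] [Finite β] (f : α → T) (g : β → T)
    (h : ∀ t, {x | f x = t}.ncard = {y | g y = t}.ncard) : ∃ e : α ≃ β, ∀ x, g (e x) = f x := by
  have : ∀ t, Nonempty ({x // f x = t} ≃ {y // g y = t}) := fun t =>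
    Finite.card_eq.1 (h t)
  let e := fun t => (this t).some
  exact ⟨Equiv.ofFiberEquiv e, fun x => Equiv.ofFiberEquiv_map e x⟩

lemma realize_atLeast [Finite V] (G : SimpleGraph V) (P : C → Set V) (m : ℕ) (i : Fin k)
    (φ : CFormula C k) (a : Fin k → V) : (atLeast m i φ).Realize G P a ↔
      m ≤ {x | φ.Realize G P (Function.update a i x)}.ncard := by
  classical
  cases nonempty_fintype V
  simp only [Realize]
  constructor
  · rintro ⟨s, hs, h⟩
    rw [← Set.ncard_coe_finset] at hs
    exact hs.trans (Set.ncard_le_ncard (fun x hx => h x hx))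
  · intro h
    refine ⟨(Set.toFinite {x | φ.Realize G P (Function.update a i x)}).toFinset, ?_, by simp⟩
    rwa [← Set.ncard_eq_toFinset_card]

/-- The back-and-forth property of equality of theories. -/
lemma exists_equiv_of_theory_eq [Finite V] [Finite W] {G : SimpleGraph V} {P : C → Set V}
    {H : SimpleGraph W} {Q : C → Set W} {a : Fin k → V} {b : Fin k → W}
    (h : theory G P a = theory H Q b) (i : Fin k) : ∃ f : V ≃ W, ∀ x,
      theory G P (Function.update a i x) = theory H Q (Function.update b i (f x)) := by
  let tV : V → Set (CFormula C k) := fun x => theory G P (Function.update a i x)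
  let tW : W → Set (CFormula C k) := fun x => theory H Q (Function.update b i x)
  obtain ⟨f, hf⟩ := exists_equiv_of_ncard_eq tV tW fun t => by
    have iso : (∃ z : V ⊕ W, Sum.elim tV tW z = t) →
        {x | tV x = t}.ncard = {y | tW y = t}.ncard := by
      rintro ⟨z, rfl⟩
      obtain ⟨φ, hφ⟩ := exists_isolating (Sum.elim tV tW)
        (by rintro (x | x) φ <;> rfl)
        (by rintro (x | x) l <;> simp [tV, tW, theory]) z
      have hV : {x | tV x = Sum.elim tV tW z} = {x | φ.Realize G P (Function.update a i x)} :=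
        Set.ext fun x => (hφ (Sum.inl x)).symm
      have hW : {x | tW x = Sum.elim tV tW z} = {x | φ.Realize H Q (Function.update b i x)} :=
        Set.ext fun x => (hφ (Sum.inr x)).symm
      rw [hV, hW]
      refine eq_of_forall_le_iff fun m => ?_
      rw [← realize_atLeast, ← realize_atLeast]
      -- The counting quantifiers compare the two fiber sizes through all their lower bounds `m`.
      exact Set.ext_iff.1 h (atLeast m i φ)
    by_cases hz : ∃ z : V ⊕ W, Sum.elim tV tW z = t
    · exact iso hz
    · have hV : {x | tV x = t} = ∅ :=
        Set.eq_empty_of_forall_notMem fun x hx => hz ⟨Sum.inl x, hx⟩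
      have hW : {x | tW x = t} = ∅ :=
        Set.eq_empty_of_forall_notMem fun x hx => hz ⟨Sum.inr x, hx⟩
      rw [hV, hW, Set.ncard_empty, Set.ncard_empty]
  exact ⟨f, fun x => (hf x).symm⟩

/-- Equality of theories is preserved when variables are copied or permuted. -/
lemma theory_comp_eq [Finite V] [Finite W] {G : SimpleGraph V} {P : C → Set V}
    {H : SimpleGraph W} {Q : C → Set W} {a : Fin k → V} {b : Fin k → W}
    (h : theory G P a = theory H Q b) (σ : Fin k → Fin k) :
    theory G P (a ∘ σ) = theory H Q (b ∘ σ) := by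
  ext φ
  refine realize_iff_of_bisim (fun a' b' => ∃ a b, ∃ σ : Fin k → Fin k,
    theory G P a = theory H Q b ∧ a' = a ∘ σ ∧ b' = b ∘ σ) ?_ ?_ ?_ ?_ φ ⟨a, b, σ, h, rfl, rfl⟩
  · rintro _ _ ⟨a, b, σ, h, rfl, rfl⟩ i j
    exact Set.ext_iff.1 h (equal (σ i) (σ j))
  · rintro _ _ ⟨a, b, σ, h, rfl, rfl⟩ i j
    exact Set.ext_iff.1 h (adj (σ i) (σ j))
  · rintro _ _ ⟨a, b, σ, h, rfl, rfl⟩ i c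
    exact Set.ext_iff.1 h (color c (σ i))
  · rintro _ _ ⟨a, b, σ, h, rfl, rfl⟩ i
    -- The `k - 1` indices other than `i` cannot use all `k` slots of `a`; the free slot `j`
    -- receives the new vertex.
    obtain ⟨j, hj⟩ : ∃ j, ∀ i', i' ≠ i → σ i' ≠ j := by
      by_contra! hcon
      have hs : Function.Surjective (fun x : {x // x ≠ i} => σ x) := fun j => by
        obtain ⟨i', h1, h2⟩ := hcon j
        exact ⟨⟨i', h1⟩, h2⟩
      have := Fintype.card_le_of_surjective _ hs
      have := Fintype.card_subtype_lt (p := fun x => x ≠ i) (x := i) (by simp)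
      omega
    obtain ⟨f, hf⟩ := exists_equiv_of_theory_eq h j
    refine ⟨f, fun x => ⟨_, _, Function.update σ i j, hf x, ?_, ?_⟩⟩ <;>
    · ext i'
      by_cases hi : i' = i
      · subst hi; simp
      · simp [hi, hj i' hi]

/-- Structures that agree on sentences have vertices with equal theories. -/
lemma exists_theory_const_eq [Finite W] [Nonempty W] (hk : 0 < k) {G : SimpleGraph V}
    {P : C → Set V} {H : SimpleGraph W} {Q : C → Set W}
    (h : ∀ φ : CFormula C k, φ.IsSentence → (∀ a, φ.Realize G P a) → ∀ b, φ.Realize H Q b)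
    (x : V) : ∃ y : W, theory G P (fun _ : Fin k => x) = theory H Q fun _ => y := by
  classical
  cases nonempty_fintype W
  by_contra! hcon
  have key : ∀ y : W, ∃ φ : CFormula C k, φ.Realize G P (fun _ => x) ∧
      ¬ φ.Realize H Q fun _ => y := by
    intro y
    by_contra! hy
    refine hcon y (Set.Subset.antisymm (fun φ hφ => hy φ hφ) fun φ hφ => ?_)
    by_contra hn
    exact hy φ.neg hn hφ
  choose ψ h1 h2 using key
  -- The equations force any witness in `H` to be a constant assignment, and the `ψ y` then exclude
  -- every constant.
  let eqs : List (CFormula C k) := (List.finRange k).map fun i => equal i ⟨0, hk⟩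
  let φ := exs (List.finRange k) (conj (eqs ++ Finset.univ.toList.map ψ))
  obtain ⟨y⟩ := ‹Nonempty W›
  have hG : ∀ a, φ.Realize G P a := fun a => by
    rw [realize_exs]
    refine ⟨fun _ => x, by simp, ?_⟩
    rw [realize_conj]
    simp only [eqs, List.mem_append, List.mem_map, List.mem_finRange, Finset.mem_toList,
      Finset.mem_univ, true_and]
    rintro _ (⟨i, rfl⟩ | ⟨z, rfl⟩)
    · rfl
    · exact h1 z
  have hH := h φ (isSentence_exs _) hG fun _ => y
  rw [realize_exs] at hH
  obtain ⟨b, -, hb⟩ := hH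
  rw [realize_conj] at hb
  have hb0 : b = fun _ => b ⟨0, hk⟩ := by
    funext i
    exact hb (equal i ⟨0, hk⟩) (by simp [eqs])
  refine h2 (b ⟨0, hk⟩) ?_
  rw [← hb0]
  exact hb _ (by simp)

end Theory

end CFormula

/-! ### Pebbled graphs and their similarity -/

/-- A vertex-colored graph with `s` placed pebbles, out of `k` available ones. -/
structure PebbledGraph (C : Type w) (V : Type u) (k s : ℕ) where
  /-- the graph -/
  graph : SimpleGraph V
  /-- the color classes -/
  col : C → Set V
  /-- the positions of the placed pebbles -/
  peb : Fin s → V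

namespace PebbledGraph

variable {C : Type w} {V : Type u} {W : Type v} {U : Type*} {k s : ℕ}

/-- The theories of assignments. -/
def th (M : PebbledGraph C V k s) (a : Fin k → V) : Set (CFormula C k) :=
  CFormula.theory M.graph M.col a

/-- Placing one more pebble. -/
def cons (x : V) (M : PebbledGraph C V k s) : PebbledGraph C V k (s + 1) :=
  ⟨M.graph, M.col, Fin.cons x M.peb⟩

/-- Every two assignments that correspond to each other under the placed pebbles and the pairs
in `A` satisfy the same formulas. -/
def Sim (M : PebbledGraph C V k s) (N : PebbledGraph C W k s) (A : Set (V × W)) : Prop :=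
  ∀ a : Fin k → V × W, (∀ i, a i ∈ A ∨ ∃ j, a i = (M.peb j, N.peb j)) →
    M.th (Prod.fst ∘ a) = N.th (Prod.snd ∘ a)

variable {M : PebbledGraph C V k s} {N : PebbledGraph C W k s} {O : PebbledGraph C U k s}

lemma Sim.mono {A B : Set (V × W)} (h : M.Sim N A) (hB : B ⊆ A) : M.Sim N B :=
  fun a ha => h a fun i => (ha i).imp_left fun h => hB h

lemma Sim.refl {A : Set (V × V)} (hA : ∀ z ∈ A, z.1 = z.2) : M.Sim M A := by
  intro a ha
  congr 1
  funext i
  rcases ha i with h | ⟨j, h⟩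
  · exact hA _ h
  · simp [h]

lemma Sim.symm {A : Set (V × W)} (h : M.Sim N A) {B : Set (W × V)}
    (hB : ∀ z ∈ B, (z.2, z.1) ∈ A) : N.Sim M B := by
  intro a ha
  refine (h (Prod.swap ∘ a) fun i => ?_).symm
  rcases ha i with h | ⟨j, h⟩
  · exact Or.inl (hB _ h)
  · exact Or.inr ⟨j, by simp [h]⟩

lemma Sim.trans {A : Set (V × W)} {B : Set (W × U)} (h : M.Sim N A) (h' : N.Sim O B)
    {E : Set (V × U)} (hE : ∀ z ∈ E, ∃ y, (z.1, y) ∈ A ∧ (y, z.2) ∈ B) : M.Sim O E := by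
  intro a ha
  have : ∀ i, ∃ y, ((a i).1, y) ∈ A ∧ (y, (a i).2) ∈ B ∨
      ∃ j, a i = (M.peb j, O.peb j) ∧ y = N.peb j := by
    intro i
    rcases ha i with h | ⟨j, h⟩
    · obtain ⟨y, hy⟩ := hE _ h
      exact ⟨y, Or.inl hy⟩
    · exact ⟨_, Or.inr ⟨j, h, rfl⟩⟩
  choose y hy using this
  refine (h (fun i => ((a i).1, y i)) fun i => ?_).trans
    (h' (fun i => (y i, (a i).2)) fun i => ?_)
  · rcases hy i with h | ⟨j, h, h2⟩
    · exact Or.inl h.1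
    · exact Or.inr ⟨j, by simp [h, h2]⟩
  · rcases hy i with h | ⟨j, h, h2⟩
    · exact Or.inl h.2
    · exact Or.inr ⟨j, by simp [h, h2]⟩

lemma sim_cons {x : V} {y : W} {A : Set (V × W)} :
    (cons x M).Sim (cons y N) A ↔ M.Sim N (insert (x, y) A) := by
  refine forall_congr' fun a => imp_congr (forall_congr' fun i => ?_) Iff.rfl
  simp only [cons, Fin.exists_fin_succ, Fin.cons_zero, Fin.cons_succ, Set.mem_insert_iff]
  tauto

/-- The back-and-forth property. -/
lemma Sim.exists_equiv [Finite V] [Finite W] {A : Set (V × W)} (h : M.Sim N A)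
    (hs : 0 < s) (hA : s + A.ncard < k) : ∃ f : V ≃ W, ∀ x, M.Sim N (insert (x, f x) A) := by
  classical
  let R : Set (V × W) := A ∪ Set.range fun j => (M.peb j, N.peb j)
  have hR : R.ncard < k := by
    refine lt_of_le_of_lt (Set.ncard_union_le _ _) ?_
    have : (Set.range fun j => (M.peb j, N.peb j)).ncard ≤ s := by
      rw [← Set.image_univ]
      refine (Set.ncard_image_le (Set.toFinite _)).trans ?_
      simp [Set.ncard_univ]
    omega
  have hk : 0 < k := by omega
  obtain ⟨m, hm⟩ : ∃ m, R.ncard = m := ⟨_, rfl⟩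
  let g : Fin m ≃ R := (finCongr (by rw [← hm]; rfl)).trans (Finite.equivFin R).symm
  have hm0 : 0 < m := by
    rw [← hm]
    exact (Set.ncard_pos).2 ⟨(M.peb ⟨0, hs⟩, N.peb ⟨0, hs⟩), Or.inr ⟨_, rfl⟩⟩
  -- The first `m < k` variables enumerate all relevant pairs, the others repeat the first pair.
  -- Variable `m` is thus redundant and free to be requantified.
  let a : Fin k → V × W := fun i => if hi : i.1 < m then g ⟨i, hi⟩ else g ⟨0, hm0⟩
  have haR : ∀ i, a i ∈ R := fun i => by
    simp only [a]; split_ifs <;> exact Subtype.coe_prop _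
  have hsurj : ∀ z ∈ R, ∃ i : Fin k, i.1 < m ∧ a i = z := by
    intro z hz
    refine ⟨⟨g.symm ⟨z, hz⟩, by omega⟩, (g.symm ⟨z, hz⟩).2, ?_⟩
    simp [a]
  have mem_R : ∀ z, z ∈ R ↔ z ∈ A ∨ ∃ j, z = (M.peb j, N.peb j) := by
    intro z; simp [R, eq_comm]
  let i₀ : Fin k := ⟨m, by omega⟩
  obtain ⟨f, hf⟩ := CFormula.exists_equiv_of_theory_eq (h a fun i => (mem_R _).1 (haR i)) i₀
  refine ⟨f, fun x b hb => ?_⟩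
  have : ∀ i, ∃ j, Function.update a i₀ (x, f x) j = b i := by
    intro i
    have : b i = (x, f x) ∨ b i ∈ R := by
      rw [mem_R]
      have := hb i
      rw [Set.mem_insert_iff] at this
      tauto
    rcases this with h | h
    · exact ⟨i₀, by simp [h]⟩
    · obtain ⟨j, hj, h2⟩ := hsurj _ h
      refine ⟨j, ?_⟩
      rw [Function.update_of_ne, h2]
      rintro rfl
      simp [i₀] at hj
  choose σ hσ using this
  have key := CFormula.theory_comp_eq (hf x) σ
  have e1 : Prod.fst ∘ b = Function.update (Prod.fst ∘ a) i₀ x ∘ σ := by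
    funext i
    rw [Function.comp_apply, ← hσ i, ← Function.comp_apply (f := Prod.fst),
      Function.comp_update]; rfl
  have e2 : Prod.snd ∘ b = Function.update (Prod.snd ∘ a) i₀ (f x) ∘ σ := by
    funext i
    rw [Function.comp_apply, ← hσ i, ← Function.comp_apply (f := Prod.snd),
      Function.comp_update]; rfl
  rw [e1, e2]
  exact key

lemma Sim.exists_pair [Finite V] [Finite W] {A : Set (V × W)} (h : M.Sim N A)
    (hs : 0 < s) (hA : s + A.ncard < k) (x : V) : ∃ y, M.Sim N (insert (x, y) A) := by
  obtain ⟨f, hf⟩ := h.exists_equiv hs hA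
  exact ⟨_, hf x⟩

lemma Sim.atoms {A : Set (V × W)} (h : M.Sim N A) (hk : 1 < k) {x y : V} {x' y' : W}
    (hx : (x, x') ∈ A) (hy : (y, y') ∈ A) : (x = y ↔ x' = y') ∧
      (M.graph.Adj x y ↔ N.graph.Adj x' y') ∧ ∀ c, x ∈ M.col c ↔ x' ∈ N.col c := by
  let i : Fin k := ⟨0, by omega⟩
  let j : Fin k := ⟨1, hk⟩
  have hij : j ≠ i := fun h => absurd (congrArg Fin.val h) one_ne_zero
  have key := h (fun l => if l = i then (x, x') else (y, y'))
    (fun l => Or.inl (by split_ifs <;> assumption))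
  have k1 := Set.ext_iff.1 key (CFormula.equal i j)
  have k2 := Set.ext_iff.1 key (CFormula.adj i j)
  have k3 := fun c => Set.ext_iff.1 key (CFormula.color c i)
  simp only [th, CFormula.theory, Set.mem_ofPred_eq, CFormula.Realize, Function.comp_apply,
    if_pos, hij, if_false] at k1 k2 k3
  exact ⟨k1, k2, k3⟩

end PebbledGraph

/-! ### Types of vertices and pairs, exceptional pairs -/

namespace PebbledGraph

variable {C : Type w} {V : Type u} {W : Type v} {U : Type*} {k s : ℕ}
variable {M : PebbledGraph C V k s} {N : PebbledGraph C W k s} {O : PebbledGraph C U k s}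

/-- The vertices `x` and `x'` have the same type. -/
def Sim₁ (M : PebbledGraph C V k s) (N : PebbledGraph C W k s) (x : V) (x' : W) : Prop :=
  M.Sim N {(x, x')}

/-- The pairs `(x, y)` and `(x', y')` have the same type. -/
def Sim₂ (M : PebbledGraph C V k s) (N : PebbledGraph C W k s) (x y : V) (x' y' : W) : Prop :=
  M.Sim N {(x, x'), (y, y')}

lemma Sim₁.refl (M : PebbledGraph C V k s) (x : V) : M.Sim₁ M x x := Sim.refl (by simp)

lemma Sim₂.refl (M : PebbledGraph C V k s) (x y : V) : M.Sim₂ M x y x y := Sim.refl (by simp)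

lemma Sim₁.symm {x : V} {x' : W} (h : M.Sim₁ N x x') : N.Sim₁ M x' x := Sim.symm h (by simp)

lemma Sim₂.symm {x y : V} {x' y' : W} (h : M.Sim₂ N x y x' y') : N.Sim₂ M x' y' x y :=
  Sim.symm h (by simp)

lemma Sim₁.trans {x : V} {x' : W} {x'' : U} (h : M.Sim₁ N x x') (h' : N.Sim₁ O x' x'') :
    M.Sim₁ O x x'' :=
  Sim.trans h h' (by simp)

lemma Sim₂.trans {x y : V} {x' y' : W} {x'' y'' : U} (h : M.Sim₂ N x y x' y')
    (h' : N.Sim₂ O x' y' x'' y'') : M.Sim₂ O x y x'' y'' :=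
  Sim.trans h h' (by
    simp only [Set.mem_insert_iff, Set.mem_singleton_iff, forall_eq_or_imp, forall_eq]
    exact ⟨⟨x', by simp⟩, ⟨y', by simp⟩⟩)

lemma Sim₂.swap {x y : V} {x' y' : W} (h : M.Sim₂ N x y x' y') : M.Sim₂ N y x y' x' :=
  Sim.mono h (Set.pair_comm _ _).subset

lemma Sim₂.left {x y : V} {x' y' : W} (h : M.Sim₂ N x y x' y') : M.Sim₁ N x x' :=
  Sim.mono h (by simp)

lemma Sim₂.right {x y : V} {x' y' : W} (h : M.Sim₂ N x y x' y') : M.Sim₁ N y y' :=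
  Sim.mono h (by simp)

section Extension

variable [Finite V] [Finite W]

lemma exists_equiv_sim₁ (h : M.Sim N ∅) (hs : 0 < s) (hk : s < k) :
    ∃ f : V ≃ W, ∀ x, M.Sim₁ N x (f x) := by
  obtain ⟨f, hf⟩ := h.exists_equiv hs (by simpa using hk)
  exact ⟨f, fun x => (hf x).mono (by simp)⟩

lemma Sim₁.exists_equiv {x : V} {x' : W} (h : M.Sim₁ N x x') (hs : 0 < s) (hk : s + 1 < k) :
    ∃ f : V ≃ W, ∀ y, M.Sim₂ N x y x' (f y) := by
  obtain ⟨f, hf⟩ := Sim.exists_equiv h hs (by simpa using hk)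
  exact ⟨f, fun y => (hf y).mono (Set.pair_comm _ _).subset⟩

lemma Sim₁.exists_sim₂ {x : V} {x' : W} (h : M.Sim₁ N x x') (hs : 0 < s) (hk : s + 1 < k)
    (y : V) : ∃ y', M.Sim₂ N x y x' y' := by
  obtain ⟨f, hf⟩ := h.exists_equiv hs hk
  exact ⟨_, hf y⟩

/-- Lets a walk from `x` to `y` be copied one vertex at a time. -/
lemma Sim₂.exists_sim {x y : V} {x' y' : W} (h : M.Sim₂ N x y x' y') (hs : 0 < s)
    (hk : s + 2 < k) (z : V) :
    ∃ z', M.Sim₂ N x y x' y' ∧ M.Sim₂ N x z x' z' ∧ M.Sim₂ N z y z' y' := by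
  have : ({(x, x'), (y, y')} : Set (V × W)).ncard ≤ 2 :=
    (Set.ncard_insert_le _ _).trans (by simp)
  obtain ⟨z', hz⟩ := Sim.exists_pair h hs (by omega) z
  refine ⟨z', h, Sim.mono hz ?_, Sim.mono hz ?_⟩ <;>
  · intro u; simp only [Set.mem_insert_iff, Set.mem_singleton_iff]; tauto

end Extension

/-- The vertices of the same type as `x`. -/
def fiber (M : PebbledGraph C V k s) (x : V) : Set V := {y | M.Sim₁ M x y}

/-- The vertices of the same type as `y` after `x` is pebbled. -/
def cell (M : PebbledGraph C V k s) (x y : V) : Set V := {z | M.Sim₂ M x y x z}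

lemma mem_fiber_self (x : V) : x ∈ M.fiber x := Sim₁.refl M x

lemma mem_cell_self (x y : V) : y ∈ M.cell x y := Sim₂.refl M x y

lemma fiber_eq_iff {x y : V} : M.fiber x = M.fiber y ↔ M.Sim₁ M x y := by
  constructor
  · intro h
    have : y ∈ M.fiber x := h ▸ mem_fiber_self y
    exact this
  · intro h
    ext z
    exact ⟨fun hz => h.symm.trans hz, fun hz => h.trans hz⟩

lemma cell_eq_iff {x y z : V} : M.cell x y = M.cell x z ↔ M.Sim₂ M x y x z := by
  constructor
  · intro h
    have : z ∈ M.cell x y := h ▸ mem_cell_self x z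
    exact this
  · intro h
    ext u
    exact ⟨fun hu => h.symm.trans hu, fun hu => h.trans hu⟩

lemma fiber_eq_of_mem {x y : V} (h : y ∈ M.fiber x) : M.fiber y = M.fiber x :=
  (fiber_eq_iff.2 h).symm

lemma cell_subset_fiber (x y : V) : M.cell x y ⊆ M.fiber y := fun _ hz => Sim₂.right hz

lemma fiber_cons (x y : V) : (cons x M).fiber y = M.cell x y := by
  ext z
  exact sim_cons

/-- Supplies the map `r` from finer to coarser parts that the potential estimates require. -/
lemma exists_coarsening (M : PebbledGraph C V k s) (x : V) :
    ∃ r : Set V → Set V, ∀ y, r (M.cell x y) = M.fiber y := by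
  have : Function.FactorsThrough M.fiber (M.cell x) := fun y z h =>
    fiber_eq_iff.2 (cell_eq_iff.1 h).right
  exact ⟨Function.extend (M.cell x) M.fiber id, fun y => this.extend_apply _ y⟩

lemma cell_self (hk : 1 < k) (x : V) : M.cell x x = {x} := by
  ext y
  constructor
  · intro h
    exact ((Sim.atoms h hk (x := x) (y := x) (x' := x) (y' := y) (by simp) (by simp)).1.1
      rfl).symm
  · rintro rfl
    exact mem_cell_self _ _

/-- The pair `(x, y)` has an exceptional type: its type is not the one of the majority of all
pairs with endpoints of the same types. -/
def Exc (M : PebbledGraph C V k s) (x y : V) : Prop :=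
  2 * (M.cell x y).ncard ≤ (M.fiber y).ncard

section

variable [Finite V] [Finite W]

lemma Sim₁.ncard_fiber {x : V} {x' : W} (h : M.Sim₁ N x x') (hs : 0 < s) (hk : s < k) :
    (M.fiber x).ncard = (N.fiber x').ncard := by
  obtain ⟨f, hf⟩ := exists_equiv_sim₁ (Sim.mono h (Set.empty_subset _)) hs hk
  have : N.fiber x' = f '' M.fiber x := by
    ext z
    rw [Equiv.image_eq_preimage_symm]
    have hz := hf (f.symm z)
    rw [Equiv.apply_symm_apply] at hz
    exact ⟨fun h' => (h.trans h').trans hz.symm, fun h' => (h.symm.trans h').trans hz⟩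
  rw [this, Set.ncard_image_of_injective _ f.injective]

lemma Sim₂.ncard_cell {x y : V} {x' y' : W} (h : M.Sim₂ N x y x' y') (hs : 0 < s)
    (hk : s + 1 < k) : (M.cell x y).ncard = (N.cell x' y').ncard := by
  obtain ⟨f, hf⟩ := h.left.exists_equiv hs hk
  have : N.cell x' y' = f '' M.cell x y := by
    ext z
    rw [Equiv.image_eq_preimage_symm]
    have hz := hf (f.symm z)
    rw [Equiv.apply_symm_apply] at hz
    exact ⟨fun h' => (h.trans h').trans hz.symm, fun h' => (h.symm.trans h').trans hz⟩
  rw [this, Set.ncard_image_of_injective _ f.injective]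

lemma Sim₂.exc_iff {x y : V} {x' y' : W} (h : M.Sim₂ N x y x' y') (hs : 0 < s)
    (hk : s + 1 < k) : M.Exc x y ↔ N.Exc x' y' := by
  rw [Exc, Exc, h.ncard_cell hs hk, h.right.ncard_fiber hs (by omega)]

/-- Double counting of the pairs of the same type as `(x, y)`. -/
lemma ncard_fiber_mul_ncard_cell (hs : 0 < s) (hk : s + 1 < k) (x y : V) :
    (M.fiber x).ncard * (M.cell x y).ncard = (M.fiber y).ncard * (M.cell y x).ncard := by
  classical
  cases nonempty_fintype V
  have key : ∀ x y : V, ((Finset.univ : Finset (V × V)).filter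
      fun z => M.Sim₂ M x y z.1 z.2).card = (M.fiber x).ncard * (M.cell x y).ncard := by
    intro x y
    rw [Finset.card_eq_sum_card_fiberwise (f := Prod.fst) (t := (M.fiber x).toFinite.toFinset)]
    · rw [Finset.sum_const_nat (m := (M.cell x y).ncard), ← Set.ncard_eq_toFinset_card]
      intro x' hx'
      replace hx' : M.Sim₁ M x x' := (Set.Finite.mem_toFinset _).1 hx'
      obtain ⟨y', hy'⟩ := hx'.exists_sim₂ hs hk y
      rw [hy'.ncard_cell hs hk, ← Set.ncard_image_of_injective _ (Prod.mk_right_injective x'),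
        ← Set.ncard_coe_finset]
      congr 1
      ext ⟨a, b⟩
      simp only [Finset.coe_filter, Finset.mem_filter, Finset.mem_univ, true_and,
        Set.mem_ofPred_eq, Set.mem_image, Prod.mk.injEq, exists_eq_right_right]
      constructor
      · rintro ⟨h, rfl⟩
        exact ⟨hy'.symm.trans h, rfl⟩
      · rintro ⟨h, rfl⟩
        exact ⟨hy'.trans h, rfl⟩
    · intro z hz
      have : M.Sim₂ M x y z.1 z.2 := by simpa using hz
      exact (Set.Finite.mem_toFinset _).2 this.left
  rw [← key, ← key]
  refine Finset.card_bij (fun z _ => z.swap) ?_ ?_ ?_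
  · intro z hz
    simp only [Finset.mem_filter, Finset.mem_univ, true_and] at hz ⊢
    exact hz.swap
  · intro a _ b _ h
    exact Prod.swap_injective h
  · intro z hz
    simp only [Finset.mem_filter, Finset.mem_univ, true_and] at hz
    exact ⟨z.swap, by simpa using hz.swap, by simp⟩

lemma ncard_fiber_pos (x : V) : 0 < (M.fiber x).ncard :=
  (Set.ncard_pos (Set.toFinite _)).2 ⟨x, mem_fiber_self x⟩

/-- By double counting, the density of a pair type among all pairs from its two fibers is the same
from both sides. -/
lemma Exc.symm {x y : V} (h : M.Exc x y) (hs : 0 < s) (hk : s + 1 < k) : M.Exc y x := by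
  have h1 := ncard_fiber_mul_ncard_cell (M := M) hs hk x y
  have hx := ncard_fiber_pos (M := M) x
  have hy := ncard_fiber_pos (M := M) y
  unfold Exc at h ⊢
  refine Nat.le_of_mul_le_mul_left ?_ hy
  calc (M.fiber y).ncard * (2 * (M.cell y x).ncard)
      = (M.fiber x).ncard * (2 * (M.cell x y).ncard) := by linarith
    _ ≤ (M.fiber x).ncard * (M.fiber y).ncard := Nat.mul_le_mul_left _ h
    _ = _ := mul_comm _ _

lemma Exc.cell_ne_fiber {x y : V} (h : M.Exc x y) : M.cell x y ≠ M.fiber y := by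
  intro heq
  have hy := ncard_fiber_pos (M := M) y
  unfold Exc at h
  rw [heq] at h
  omega

/-- The type of an unexceptional pair is determined by the types of its endpoints. -/
lemma sim₂_of_not_exc {x y : V} {x' y' : W} (hx : M.Sim₁ N x x') (hy : M.Sim₁ N y y')
    (hM : ¬ M.Exc x y) (hN : ¬ N.Exc x' y') (hs : 0 < s) (hk : s + 1 < k) :
    M.Sim₂ N x y x' y' := by
  obtain ⟨z, hz⟩ := hx.exists_sim₂ hs hk y
  have hNz := (hz.exc_iff hs hk).not.1 hM
  have hzy : N.fiber z = N.fiber y' := fiber_eq_iff.2 (hz.right.symm.trans hy)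
  refine hz.trans (cell_eq_iff.1 ?_)
  by_contra hne
  -- Two different cells in one fiber cannot both contain more than half of it.
  have hdisj : Disjoint (N.cell x' z) (N.cell x' y') := by
    rw [Set.disjoint_left]
    intro u h1 h2
    exact hne (cell_eq_iff.2 (Sim₂.trans h1 (Sim₂.symm h2)))
  have hsub : N.cell x' z ∪ N.cell x' y' ⊆ N.fiber y' :=
    Set.union_subset (hzy ▸ cell_subset_fiber x' z) (cell_subset_fiber x' y')
  have := Set.ncard_le_ncard hsub
  rw [Set.ncard_union_eq hdisj] at this
  unfold Exc at hNz hN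
  rw [hzy] at hNz
  omega

end

end PebbledGraph

/-! ### The potential of a partition -/

section Potential

open Finset

variable {V T T' : Type*} [Fintype V] [DecidableEq T] [DecidableEq T']

/-- The number of elements with a given image. -/
def fiberCard (f : V → T) (t : T) : ℕ := #{v | f v = t}

/-- A potential of partitions: each part has a value of `L`, plus up to `3 * L` for its size. -/
def potential (L : ℕ) (f : V → T) : ℕ := ∑ t ∈ univ.image f, (L + 3 * min (fiberCard f t) L)

lemma sum_fiberCard (f : V → T) : ∑ t ∈ univ.image f, fiberCard f t = Fintype.card V :=
  (card_eq_sum_card_image f univ).symm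

/-- A nonempty part of size `c` contributes at most `c * (L + 3)`. -/
lemma potential_le (L : ℕ) (f : V → T) : potential L f ≤ Fintype.card V * (L + 3) := by
  rw [← sum_fiberCard f, sum_mul]
  refine sum_le_sum fun t ht => ?_
  have : 0 < fiberCard f t := by
    obtain ⟨v, -, rfl⟩ := mem_image.1 ht
    exact card_pos.2 ⟨v, by simp⟩
  have := min_le_left (fiberCard f t) L
  nlinarith

/-- The parts of the partition into fibers of `g` contained in a fiber of the coarser `r ∘ g`. -/
def subparts (g : V → T') (r : T' → T) (t : T) : Finset T' := {u ∈ univ.image g | r u = t}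

variable {f : V → T} {g : V → T'} {r : T' → T}

lemma mem_subparts {t : T} {u : T'} : u ∈ subparts g r t ↔ (∃ v, g v = u) ∧ r u = t := by
  simp [subparts]

lemma sum_subparts (hr : ∀ v, r (g v) = f v) (φ : T' → ℕ) :
    ∑ t ∈ univ.image f, ∑ u ∈ subparts g r t, φ u = ∑ u ∈ univ.image g, φ u := by
  refine sum_fiberwise_of_maps_to (fun u hu => ?_) φ
  obtain ⟨v, -, rfl⟩ := mem_image.1 hu
  simp [hr]

lemma sum_fiberCard_subparts (hr : ∀ v, r (g v) = f v) (t : T) :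
    ∑ u ∈ subparts g r t, fiberCard g u = fiberCard f t := by
  refine (card_eq_sum_card_fiberwise (f := g) fun v hv => ?_).trans
    (sum_congr rfl fun u hu => ?_) |>.symm
  · have : f v = t := by simpa using hv
    simp [mem_subparts, hr, this]
  · rw [fiberCard, filter_filter]
    congr 1
    ext v
    simp only [mem_filter, mem_univ, true_and, and_iff_right_iff_imp]
    rintro rfl
    rw [← hr]
    exact (mem_subparts.1 hu).2

lemma min_sum_le (s : Finset T') (φ : T' → ℕ) (L : ℕ) :
    min (∑ u ∈ s, φ u) L ≤ ∑ u ∈ s, min (φ u) L := by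
  induction s using Finset.induction_on with
  | empty => simp
  | insert a s ha ih => rw [sum_insert ha, sum_insert ha]; omega

/-- Truncation at `L` is subadditive, so splitting a part never lowers the size terms, while each
extra part adds `L`. -/
lemma subparts_weight (hr : ∀ v, r (g v) = f v) (L : ℕ) (t : T) :
    L * #(subparts g r t) + 3 * min (fiberCard f t) L ≤
      ∑ u ∈ subparts g r t, (L + 3 * min (fiberCard g u) L) := by
  rw [sum_add_distrib, sum_const, smul_eq_mul, ← mul_sum, ← sum_fiberCard_subparts hr, mul_comm]
  have := min_sum_le (subparts g r t) (fiberCard g) L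
  omega

lemma one_le_card_subparts (hr : ∀ v, r (g v) = f v) {t : T} (ht : t ∈ univ.image f) :
    1 ≤ #(subparts g r t) := by
  obtain ⟨v, -, rfl⟩ := mem_image.1 ht
  exact card_pos.2 ⟨g v, mem_subparts.2 ⟨⟨v, rfl⟩, hr v⟩⟩

lemma subparts_weight' (hr : ∀ v, r (g v) = f v) (L : ℕ) {t : T} (ht : t ∈ univ.image f) :
    L + 3 * min (fiberCard f t) L ≤ ∑ u ∈ subparts g r t, (L + 3 * min (fiberCard g u) L) := by
  refine le_trans ?_ (subparts_weight hr L t)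
  have := Nat.mul_le_mul_left L (one_le_card_subparts hr ht)
  omega

lemma card_image_le_of_potential_lt (hr : ∀ v, r (g v) = f v) {L : ℕ}
    (h : potential L g < potential L f + 4 * L) : #(univ.image g) ≤ #(univ.image f) + 3 := by
  have h1 : potential L f + L * #(univ.image g) ≤ potential L g + L * #(univ.image f) := by
    have e1 : #(univ.image g) = ∑ t ∈ univ.image f, #(subparts g r t) := by
      simpa using (sum_subparts hr fun _ => 1).symm
    rw [e1, potential, potential, ← sum_subparts hr, mul_sum, ← sum_add_distrib, mul_comm L,
      ← smul_eq_mul, ← sum_const, ← sum_add_distrib]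
    refine sum_le_sum fun t _ => ?_
    have := subparts_weight hr L t
    omega
  by_contra! hcon
  have : L * (#(univ.image f) + 4) ≤ L * #(univ.image g) := Nat.mul_le_mul_left L hcon
  linarith

/-- Two large subparts of one part would have potential `8 * L`, whereas the part itself had at most
`4 * L`. -/
lemma eq_of_potential_lt (hr : ∀ v, r (g v) = f v) {L : ℕ}
    (h : potential L g < potential L f + 4 * L) {v v' : V} (hv : f v = f v')
    (h1 : L ≤ fiberCard g (g v)) (h2 : L ≤ fiberCard g (g v')) : g v = g v' := by
  by_contra hne
  refine absurd h (not_lt.2 ?_)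
  have ht : f v ∈ univ.image f := by simp
  rw [potential, potential, ← sum_subparts hr, ← add_sum_erase _ _ ht, ← add_sum_erase _ _ ht]
  have h3 : ∑ t ∈ (univ.image f).erase (f v), (L + 3 * min (fiberCard f t) L) ≤
      ∑ t ∈ (univ.image f).erase (f v),
        ∑ u ∈ subparts g r t, (L + 3 * min (fiberCard g u) L) :=
    sum_le_sum fun t ht => subparts_weight' hr L (mem_of_mem_erase ht)
  have h4 : ∑ u ∈ ({g v, g v'} : Finset T'), (L + 3 * min (fiberCard g u) L) ≤
      ∑ u ∈ subparts g r (f v), (L + 3 * min (fiberCard g u) L) := by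
    refine sum_le_sum_of_subset fun u hu => ?_
    rw [mem_insert, mem_singleton] at hu
    rcases hu with rfl | rfl
    · exact mem_subparts.2 ⟨⟨_, rfl⟩, hr _⟩
    · exact mem_subparts.2 ⟨⟨_, rfl⟩, by rw [hr, hv]⟩
  rw [sum_pair hne, min_eq_right h1, min_eq_right h2] at h4
  have := min_le_right (fiberCard f (f v)) L
  omega

lemma sum_card_subparts_sub_one_le (hr : ∀ v, r (g v) = f v)
    (h : #(univ.image g) ≤ #(univ.image f) + 3) :
    ∑ t ∈ univ.image f, (#(subparts g r t) - 1) ≤ 3 := by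
  have e1 : #(univ.image g) = ∑ t ∈ univ.image f, #(subparts g r t) := by
    simpa using (sum_subparts hr fun _ => 1).symm
  have e2 : ∑ t ∈ univ.image f, (#(subparts g r t) - 1) + #(univ.image f) =
      ∑ t ∈ univ.image f, #(subparts g r t) := by
    rw [card_eq_sum_ones, ← sum_add_distrib]
    refine sum_congr rfl fun t ht => ?_
    have := one_le_card_subparts hr ht
    omega
  omega

lemma card_split_le (hr : ∀ v, r (g v) = f v) (h : #(univ.image g) ≤ #(univ.image f) + 3) :
    #{t ∈ univ.image f | 2 ≤ #(subparts g r t)} ≤ 3 := by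
  refine le_trans ?_ (sum_card_subparts_sub_one_le hr h)
  rw [card_eq_sum_ones, sum_filter]
  refine sum_le_sum fun t _ => ?_
  split_ifs <;> omega

/-- A part split into `m ≥ 2` pieces satisfies `m ≤ 2 * (m - 1)`, and the excesses `m - 1` sum to at
most 3. -/
lemma card_split_parts_le (hr : ∀ v, r (g v) = f v) (h : #(univ.image g) ≤ #(univ.image f) + 3) :
    #{u ∈ univ.image g | 2 ≤ #(subparts g r (r u))} ≤ 6 := by
  have h1 := Nat.mul_le_mul_left 2 (sum_card_subparts_sub_one_le hr h)
  refine le_trans ?_ h1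
  rw [card_eq_sum_ones, sum_filter, ← sum_subparts hr, mul_sum]
  refine sum_le_sum fun t _ => ?_
  have : ∑ u ∈ subparts g r t, (if 2 ≤ #(subparts g r (r u)) then 1 else 0) =
      ∑ u ∈ subparts g r t, (if 2 ≤ #(subparts g r t) then 1 else 0) :=
    sum_congr rfl fun u hu => by rw [(mem_subparts.1 hu).2]
  rw [this, sum_const]
  split_ifs
  · simp; omega
  · simp

lemma card_subparts_le (hr : ∀ v, r (g v) = f v) (h : #(univ.image g) ≤ #(univ.image f) + 3)
    (v : V) : #(subparts g r (f v)) ≤ 4 := by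
  have h1 := sum_card_subparts_sub_one_le hr h
  have h2 := single_le_sum (f := fun t => #(subparts g r t) - 1) (fun _ _ => Nat.zero_le _)
    (mem_image_of_mem f (mem_univ v))
  have h3 : #(subparts g r (f v)) - 1 ≤ 3 := h2.trans h1
  omega

end Potential

lemma ncard_sUnion_le {V : Type*} [Finite V] {S : Set (Set V)} {m n : ℕ} (hS : S.ncard ≤ n)
    (h : ∀ A ∈ S, A.ncard ≤ m) : (⋃₀ S).ncard ≤ n * m := by
  classical
  cases nonempty_fintype V
  have e : ⋃₀ S = ((S.toFinite.toFinset.biUnion fun A => A.toFinite.toFinset : Finset V) :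
      Set V) := by
    ext x; simp
  rw [e, Set.ncard_coe_finset]
  refine (Finset.card_biUnion_le_card_mul _ _ m fun A hA => ?_).trans
    (Nat.mul_le_mul_right _ ?_)
  · rw [← Set.ncard_eq_toFinset_card]
    exact h A (by simpa using hA)
  · rwa [← Set.ncard_eq_toFinset_card]

lemma ncard_biUnion_le {V W : Type*} [Finite V] [Finite W] {S : Set W} (f : W → Set V) {m n : ℕ}
    (hS : S.ncard ≤ n) (h : ∀ x ∈ S, (f x).ncard ≤ m) : (⋃ x ∈ S, f x).ncard ≤ n * m := by
  rw [← Set.sUnion_image]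
  refine ncard_sUnion_le ((Set.ncard_image_le S.toFinite).trans hS) ?_
  rintro _ ⟨x, hx, rfl⟩
  exact h x hx

/-! ### Consequences of terminality for exceptional pairs and links -/

namespace PebbledGraph

open Classical in
/-- No further pebble gains much potential. -/
structure Terminal {C : Type w} {V : Type u} {k s : ℕ} [Fintype V] (M : PebbledGraph C V k s)
    (L : ℕ) : Prop where
  pos : 0 < s
  room : s + 2 < k
  gain : ∀ x, potential L (cons x M).fiber < potential L M.fiber + 4 * L

variable {C : Type w} {V : Type u} {k s L : ℕ} [Fintype V] {M : PebbledGraph C V k s}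

open Classical in
lemma Terminal.potential_lt (hM : M.Terminal L) (x : V) :
    potential L (M.cell x) < potential L M.fiber + 4 * L := by
  have := hM.gain x
  rwa [show (cons x M).fiber = M.cell x from funext (fiber_cons x)] at this

open Classical in
lemma two_le_card_subparts {x : V} {r : Set V → Set V} (hr : ∀ y, r (M.cell x y) = M.fiber y)
    {y : V} (h : M.cell x y ≠ M.fiber y) :
    2 ≤ (subparts (M.cell x) r (M.fiber y)).card := by
  obtain ⟨z, hz, hz'⟩ := Set.exists_of_ssubset ((cell_subset_fiber x y).ssubset_of_ne h)
  have hne : M.cell x y ≠ M.cell x z := fun h => hz' (h ▸ mem_cell_self x z)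
  rw [← Finset.card_pair hne]
  refine Finset.card_le_card fun u hu => ?_
  rw [Finset.mem_insert, Finset.mem_singleton] at hu
  rcases hu with rfl | rfl
  · exact mem_subparts.2 ⟨⟨_, rfl⟩, hr _⟩
  · exact mem_subparts.2 ⟨⟨_, rfl⟩, by rw [hr, fiber_eq_of_mem hz]⟩

lemma Terminal.ncard_split_le (hM : M.Terminal L) (x : V) :
    {X | ∃ y, M.fiber y = X ∧ M.cell x y ≠ M.fiber y}.ncard ≤ 3 := by
  classical
  obtain ⟨r, hr⟩ := exists_coarsening M x
  refine le_trans ?_ (card_split_le hr (card_image_le_of_potential_lt hr (hM.potential_lt x)))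
  rw [← Set.ncard_coe_finset]
  refine Set.ncard_le_ncard ?_
  rintro _ ⟨y, rfl, hy⟩
  simp [two_le_card_subparts hr hy]

lemma Terminal.ncard_split_cells_le (hM : M.Terminal L) (x : V) :
    {c | ∃ y, M.cell x y = c ∧ M.cell x y ≠ M.fiber y}.ncard ≤ 6 := by
  classical
  obtain ⟨r, hr⟩ := exists_coarsening M x
  refine le_trans ?_
    (card_split_parts_le hr (card_image_le_of_potential_lt hr (hM.potential_lt x)))
  rw [← Set.ncard_coe_finset]
  refine Set.ncard_le_ncard ?_
  rintro _ ⟨y, rfl, hy⟩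
  simp [hr, two_le_card_subparts hr hy]

lemma Terminal.ncard_cells_le (hM : M.Terminal L) (x y : V) :
    {c | ∃ z ∈ M.fiber y, M.cell x z = c}.ncard ≤ 4 := by
  classical
  obtain ⟨r, hr⟩ := exists_coarsening M x
  refine le_trans ?_
    (card_subparts_le hr (card_image_le_of_potential_lt hr (hM.potential_lt x)) y)
  rw [← Set.ncard_coe_finset]
  refine Set.ncard_le_ncard ?_
  rintro _ ⟨z, hz, rfl⟩
  exact mem_subparts.2 ⟨⟨_, rfl⟩, by rw [hr, fiber_eq_of_mem hz]⟩

open Classical in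
lemma fiberCard_cell (x y : V) : fiberCard (M.cell x) (M.cell x y) = (M.cell x y).ncard := by
  rw [fiberCard, ← Set.ncard_coe_finset]
  congr 1
  ext z
  simp only [Finset.coe_filter, Finset.mem_univ, true_and, Set.mem_ofPred_eq]
  rw [eq_comm, cell_eq_iff]
  rfl

lemma Terminal.cell_eq (hM : M.Terminal L) {x y z : V} (hz : z ∈ M.fiber y)
    (h1 : L ≤ (M.cell x y).ncard) (h2 : L ≤ (M.cell x z).ncard) : M.cell x y = M.cell x z := by
  classical
  obtain ⟨r, hr⟩ := exists_coarsening M x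
  refine eq_of_potential_lt hr (hM.potential_lt x) (fiber_eq_of_mem hz).symm ?_ ?_ <;>
    rwa [fiberCard_cell]

/-- If the cell has size at least `L`, then the at most 3 other cells of its fiber are smaller than
`L`. An exceptional cell is no larger than all of these together. -/
lemma Terminal.ncard_cell_le (hM : M.Terminal L) {x y : V} (h : M.Exc x y) :
    (M.cell x y).ncard ≤ 3 * L := by
  by_cases hL : (M.cell x y).ncard < L
  · omega
  let S : Set (Set V) := {c | ∃ z ∈ M.fiber y, M.cell x z = c} \ {M.cell x y}
  have hS : S.ncard ≤ 3 := by
    have := hM.ncard_cells_le x y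
    rw [Set.ncard_sdiff_singleton_of_mem (by exact ⟨y, mem_fiber_self y, rfl⟩)]
    omega
  have hU : (⋃₀ S).ncard ≤ 3 * L := by
    refine ncard_sUnion_le hS ?_
    rintro _ ⟨⟨z, hz, rfl⟩, hne⟩
    by_contra! hcon
    exact hne (hM.cell_eq hz (by omega) hcon.le).symm
  have hsub : M.fiber y ⊆ M.cell x y ∪ ⋃₀ S := by
    intro z hz
    by_cases hzy : M.cell x z = M.cell x y
    · exact Or.inl (hzy ▸ mem_cell_self x z)
    · exact Or.inr ⟨_, ⟨⟨z, hz, rfl⟩, hzy⟩, mem_cell_self x z⟩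
  have h1 := (Set.ncard_le_ncard hsub).trans (Set.ncard_union_le _ _)
  unfold Exc at h
  omega

lemma Terminal.ncard_exc_le (hM : M.Terminal L) (x : V) : {y | M.Exc x y}.ncard ≤ 18 * L := by
  have hS : {c | ∃ y, M.cell x y = c ∧ M.Exc x y}.ncard ≤ 6 := by
    refine le_trans (Set.ncard_le_ncard ?_) (hM.ncard_split_cells_le x)
    rintro _ ⟨y, rfl, hy⟩
    exact ⟨y, rfl, hy.cell_ne_fiber⟩
  have hU : (⋃₀ {c | ∃ y, M.cell x y = c ∧ M.Exc x y}).ncard ≤ 6 * (3 * L) := by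
    refine ncard_sUnion_le hS ?_
    rintro _ ⟨y, rfl, hy⟩
    exact hM.ncard_cell_le hy
  refine (Set.ncard_le_ncard fun y hy => ?_).trans (hU.trans (by omega))
  exact ⟨_, ⟨y, rfl, hy⟩, mem_cell_self x y⟩

/-- Two fibers are linked by exceptional pairs. -/
def Link (M : PebbledGraph C V k s) (X Y : Set V) : Prop :=
  X ≠ Y ∧ ∃ x y, M.fiber x = X ∧ M.fiber y = Y ∧ M.Exc x y

lemma cell_eq_fiber_of_fiber_eq_singleton (hs : 0 < s) (hk : s + 1 < k) {x : V}
    (h : M.fiber x = {x}) (y : V) : M.cell x y = M.fiber y := by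
  refine (cell_subset_fiber x y).antisymm fun z hz => ?_
  obtain ⟨x', hx'⟩ := Sim₁.exists_sim₂ hz hs hk x
  have : x' ∈ M.fiber x := hx'.right
  rw [h, Set.mem_singleton_iff] at this
  subst this
  exact hx'.swap

lemma Link.exists_exc {X Y : Set V} (h : M.Link X Y) (hs : 0 < s) (hk : s + 1 < k) {x : V}
    (hx : M.fiber x = X) : ∃ y, M.fiber y = Y ∧ M.Exc x y := by
  obtain ⟨-, x', y', rfl, rfl, he⟩ := h
  obtain ⟨y, hy⟩ := (fiber_eq_iff.1 hx.symm).exists_sim₂ hs hk y'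
  exact ⟨y, fiber_eq_iff.2 hy.right.symm, (hy.exc_iff hs hk).1 he⟩

lemma Link.symm {X Y : Set V} (h : M.Link X Y) (hs : 0 < s) (hk : s + 1 < k) : M.Link Y X := by
  obtain ⟨hne, x', y', h1, h2, he⟩ := h
  exact ⟨hne.symm, y', x', h2, h1, he.symm hs hk⟩

/-- Pebbling a vertex `x` of `X` splits every fiber linked to `X`. It also splits `X` itself, since
`x` gets isolated and a singleton fiber has no exceptional pairs to other vertices' fibers. Only 3
fibers can split. -/
lemma Terminal.ncard_link_le (hM : M.Terminal L) (X : Set V) : {Y | M.Link X Y}.ncard ≤ 2 := by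
  rcases Set.eq_empty_or_nonempty {Y | M.Link X Y} with h | ⟨Y, hY⟩
  · simp [h]
  obtain ⟨-, x, y, rfl, rfl, he⟩ := id hY
  have hs := hM.pos
  have hk : s + 1 < k := by have := hM.room; omega
  have hx : M.cell x x ≠ M.fiber x := by
    intro h
    rw [cell_self (by omega)] at h
    exact he.cell_ne_fiber (cell_eq_fiber_of_fiber_eq_singleton hs hk h.symm y)
  have hsub : {Y | M.Link (M.fiber x) Y} ⊆
      {X | ∃ y, M.fiber y = X ∧ M.cell x y ≠ M.fiber y} \ {M.fiber x} := by
    intro Z hZ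
    obtain ⟨z, rfl, hz⟩ := Link.exists_exc hZ hs hk rfl
    exact ⟨⟨z, rfl, hz.cell_ne_fiber⟩, hZ.1.symm⟩
  have h1 := Set.ncard_le_ncard hsub
  rw [Set.ncard_sdiff_singleton_of_mem (by exact ⟨x, rfl, hx⟩)] at h1
  have := hM.ncard_split_le x
  omega

end PebbledGraph

/-! ### Components of the graph of exceptional pairs -/

namespace PebbledGraph

variable {C : Type w} {V : Type u} {W : Type v} {k s L : ℕ}
variable {M : PebbledGraph C V k s} {N : PebbledGraph C W k s}

/-- The vertices at distance at most `r` from `x` in the graph of exceptional pairs. -/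
def ball (M : PebbledGraph C V k s) : ℕ → V → Set V
  | 0, x => {x}
  | r + 1, x => {y | ∃ z ∈ M.ball r x, z = y ∨ M.Exc z y}

lemma ball_subset_succ (r : ℕ) (x : V) : M.ball r x ⊆ M.ball (r + 1) x :=
  fun y hy => ⟨y, hy, Or.inl rfl⟩

lemma ball_mono (x : V) : Monotone fun r => M.ball r x :=
  monotone_nat_of_le_succ fun r => ball_subset_succ r x

lemma mem_ball_trans {r t : ℕ} {x y z : V} (h : y ∈ M.ball r x) (h' : z ∈ M.ball t y) :
    z ∈ M.ball (r + t) x := by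
  induction t generalizing z with
  | zero =>
    have : z = y := h'
    rwa [this]
  | succ t ih =>
    obtain ⟨u, hu, hz⟩ := h'
    exact ⟨u, ih hu, hz⟩

lemma mem_ball_one {x y : V} (h : x = y ∨ M.Exc x y) : y ∈ M.ball 1 x := ⟨x, rfl, h⟩

lemma mem_ball_symm [Finite V] (hs : 0 < s) (hk : s + 1 < k) {r : ℕ} {x y : V}
    (h : y ∈ M.ball r x) : x ∈ M.ball r y := by
  induction r generalizing y with
  | zero => exact Eq.symm h
  | succ r ih =>
    obtain ⟨z, hz, h⟩ := h
    rw [add_comm]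
    exact mem_ball_trans (mem_ball_one (h.imp Eq.symm fun h => h.symm hs hk)) (ih hz)

/-- Exceptional walks are transported step by step, so pair types determine distances. In
particular, balls around `x` are unions of cells of `x`. -/
lemma Sim₂.mem_ball [Finite V] [Finite W] (hs : 0 < s) (hk : s + 2 < k) {r : ℕ} {x y : V}
    {x' y' : W} (h : M.Sim₂ N x y x' y') (hy : y ∈ M.ball r x) : y' ∈ N.ball r x' := by
  induction r generalizing y y' with
  | zero =>
    have : y = x := hy
    subst this
    exact ((Sim.atoms h (by omega) (x := y) (y := y) (x' := y') (y' := x')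
      (by simp) (by simp)).1.1 rfl)
  | succ r ih =>
    obtain ⟨z, hz, hzy⟩ := hy
    obtain ⟨z', h1, h2, h3⟩ := h.exists_sim hs hk z
    refine ⟨z', ih h2 hz, hzy.imp (fun e => ?_) fun e => (h3.exc_iff hs (by omega)).1 e⟩
    exact (Sim.atoms h3 (by omega) (x := z) (y := y) (by simp) (by simp)).1.1 e

/-- The component of `x` in the graph of exceptional pairs. -/
def comp (M : PebbledGraph C V k s) (x : V) : Set V := {y | ∃ r, y ∈ M.ball r x}

lemma mem_comp_self (x : V) : x ∈ M.comp x := ⟨0, rfl⟩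

lemma mem_comp_of_exc {x y z : V} (h : y ∈ M.comp x) (h' : M.Exc y z) : z ∈ M.comp x := by
  obtain ⟨r, hr⟩ := h
  exact ⟨r + 1, y, hr, Or.inr h'⟩

lemma comp_eq_of_mem [Finite V] (hs : 0 < s) (hk : s + 1 < k) {x y : V} (h : y ∈ M.comp x) :
    M.comp y = M.comp x := by
  obtain ⟨r, hr⟩ := h
  ext z
  constructor
  · rintro ⟨t, ht⟩
    exact ⟨r + t, mem_ball_trans hr ht⟩
  · rintro ⟨t, ht⟩
    exact ⟨r + t, mem_ball_trans (mem_ball_symm hs hk hr) ht⟩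

lemma comp_subset_of_closed {x : V} {S : Set V} (hx : x ∈ S)
    (h : ∀ y ∈ S, ∀ z, M.Exc y z → z ∈ S) : M.comp x ⊆ S := by
  rintro y ⟨r, hy⟩
  induction r generalizing y with
  | zero =>
    have : y = x := hy
    rwa [this]
  | succ r ih =>
    obtain ⟨z, hz, rfl | hzy⟩ := hy
    · exact ih hz
    · exact h z (ih hz) y hzy

variable [Fintype V]

lemma Terminal.ncard_ball_le (hM : M.Terminal L) (r : ℕ) (x : V) :
    (M.ball r x).ncard ≤ (18 * L + 1) ^ r := by
  induction r with
  | zero => simp [ball]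
  | succ r ih =>
    have hsub : M.ball (r + 1) x ⊆ ⋃ z ∈ M.ball r x, insert z {y | M.Exc z y} := by
      rintro y ⟨z, hz, hzy⟩
      exact Set.mem_biUnion hz (hzy.imp_left Eq.symm)
    rw [pow_succ]
    refine (Set.ncard_le_ncard hsub).trans (ncard_biUnion_le _ ih fun z _ => ?_)
    exact (Set.ncard_insert_le _ _).trans (Nat.succ_le_succ (hM.ncard_exc_le z))

/-- Each ball that grows strictly meets a new cell. The ball of radius 6 meets only cells of split
fibers, of which there are at most 6, so growth stops before radius 6. -/
lemma Terminal.ncard_comp_le (hM : M.Terminal L) {x : V}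
    (h : ∀ y ∈ M.ball 6 x, M.cell x y ≠ M.fiber y) : (M.comp x).ncard ≤ (18 * L + 1) ^ 6 := by
  obtain ⟨r, hr, hsat⟩ : ∃ r < 6, M.ball (r + 1) x = M.ball r x := by
    by_contra! hcon
    have key : ∀ r ≤ 6, r + 1 ≤ ((M.cell x) '' M.ball r x).ncard := by
      intro r hr
      induction r with
      | zero => simp [ball]
      | succ r ih =>
        refine Nat.succ_le_of_lt (lt_of_le_of_lt (ih (by omega)) (Set.ncard_lt_ncard ?_))
        refine (Set.image_mono (ball_subset_succ r x)).ssubset_of_ne fun heq => ?_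
        refine hcon r hr ((ball_subset_succ r x).antisymm' fun y hy => ?_)
        have hy' : M.cell x y ∈ (M.cell x) '' M.ball (r + 1) x := ⟨y, hy, rfl⟩
        rw [← heq] at hy'
        obtain ⟨z, hz, hzy⟩ := hy'
        exact (cell_eq_iff.1 hzy).mem_ball hM.pos hM.room hz
    have h1 := key 6 le_rfl
    have h2 : ((M.cell x) '' M.ball 6 x).ncard ≤ 6 := by
      refine le_trans (Set.ncard_le_ncard ?_) (hM.ncard_split_cells_le x)
      rintro _ ⟨y, hy, rfl⟩
      exact ⟨y, rfl, h y hy⟩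
    omega
  have hsub : M.comp x ⊆ M.ball r x := by
    refine comp_subset_of_closed (ball_mono x (Nat.zero_le r) rfl) fun y hy z hz => ?_
    rw [← hsat]
    exact ⟨y, hy, Or.inr hz⟩
  exact (Set.ncard_le_ncard (hsub.trans (ball_mono x hr.le))).trans (hM.ncard_ball_le 6 x)

/-- Components of the graph of exceptional pairs have few vertices of each type. -/
lemma Terminal.ncard_comp_inter_fiber_le (hM : M.Terminal L) (x y : V) :
    (M.comp x ∩ M.fiber y).ncard ≤ (18 * L + 1) ^ 12 := by
  have hs := hM.pos
  have hk := hM.room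
  rcases Set.eq_empty_or_nonempty (M.comp x ∩ M.fiber y) with h | ⟨z, hz, hz'⟩
  · simp [h]
  rw [← comp_eq_of_mem hs (by omega) hz, ← fiber_eq_of_mem hz']
  -- Otherwise some unsplit fiber lies entirely in the ball of radius 6 around `z`. It is therefore
  -- small, and every vertex of the type of `z` is within distance 6 of it.
  by_cases h : ∀ y ∈ M.ball 6 z, M.cell z y ≠ M.fiber y
  · refine (Set.ncard_le_ncard Set.inter_subset_left).trans ((hM.ncard_comp_le h).trans ?_)
    exact Nat.pow_le_pow_right (by omega) (by norm_num)
  · push Not at h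
    obtain ⟨u, hu, hcell⟩ := h
    have h1 : (M.fiber u).ncard ≤ (18 * L + 1) ^ 6 := by
      refine le_trans (Set.ncard_le_ncard fun t ht => ?_) (hM.ncard_ball_le 6 z)
      rw [← hcell] at ht
      exact Sim₂.mem_ball hs hk ht hu
    have h2 : M.fiber z ⊆ ⋃ t ∈ M.fiber u, M.ball 6 t := by
      intro z' hz'
      obtain ⟨t, ht⟩ := Sim₁.exists_sim₂ hz' hs (by omega) u
      exact Set.mem_biUnion ht.right (mem_ball_symm hs (by omega) (ht.mem_ball hs hk hu))
    refine (Set.ncard_le_ncard (Set.inter_subset_right.trans h2)).trans ?_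
    rw [show 12 = 6 + 6 from rfl, pow_add]
    exact ncard_biUnion_le _ h1 fun t _ => hM.ncard_ball_le 6 t

end PebbledGraph

/-! ### Matching parts of equal size -/

section Matching

variable {V W α β : Type*} [Finite V] [Finite W]

lemma ncard_preimage_eq_mul (c : V → α) (hc : c.Surjective) (A : Set α) {m : ℕ}
    (h : ∀ a ∈ A, {x | c x = a}.ncard = m) : {x | c x ∈ A}.ncard = A.ncard * m := by
  classical
  cases nonempty_fintype V
  have : Finite α := Finite.of_surjective c hc
  cases nonempty_fintype α
  have e : {x | c x ∈ A} = ((Finset.univ.filter fun x => c x ∈ A : Finset V) : Set V) := by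
    ext; simp
  rw [e, Set.ncard_coe_finset, Finset.card_eq_sum_card_fiberwise (f := c)
    (t := A.toFinite.toFinset) (fun x hx => by simpa using hx),
    Finset.sum_const_nat (m := m), ← Set.ncard_eq_toFinset_card]
  intro a ha
  have ha' : a ∈ A := by simpa using ha
  rw [← h a ha', ← Set.ncard_coe_finset]
  congr 1
  ext x
  simp only [Finset.coe_filter, Finset.mem_filter, Finset.mem_univ, true_and, Set.mem_ofPred_eq]
  exact ⟨fun h => h.2, fun h => ⟨h ▸ ha', h⟩⟩

/-- If a bijection maps the elements of each part of a partition to elements of related parts of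
another one, and related parts have the same size, then there is a bijection of related parts. -/
lemma exists_equiv_of_difunctional (c : V → α) (d : W → β) (hc : c.Surjective)
    (hd : d.Surjective) (r : α → β → Prop)
    (hr : ∀ a b a' b', r a b → r a' b → r a' b' → r a b')
    (hcard : ∀ a b, r a b → {x | c x = a}.ncard = {y | d y = b}.ncard)
    (f : V ≃ W) (hf : ∀ x, r (c x) (d (f x))) : ∃ π : α ≃ β, ∀ a, r a (π a) := by
  have : Finite α := Finite.of_surjective c hc
  have : Finite β := Finite.of_surjective d hd
  -- Difunctionality makes `r` a disjoint union of complete bipartite blocks. `F` and `G` label the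
  -- two sides of a block by the same subset of `β`.
  let F : α → Set β := fun a => {b | r a b}
  let G : β → Set β := fun b => {b' | ∃ a, r a b ∧ r a b'}
  have hFG : ∀ a b, r a b → F a = G b := by
    intro a b hab
    ext b'
    exact ⟨fun h => ⟨a, hab, h⟩, fun ⟨a', h1, h2⟩ => hr a b a' b' hab h1 h2⟩
  have hβ : ∀ b, ∃ a, r a b := by
    intro b
    obtain ⟨y, rfl⟩ := hd b
    exact ⟨c (f.symm y), by simpa using hf (f.symm y)⟩
  have hα : ∀ a, ∃ b, r a b := by
    intro a
    obtain ⟨x, rfl⟩ := hc a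
    exact ⟨_, hf x⟩
  obtain ⟨π, hπ⟩ := CFormula.exists_equiv_of_ncard_eq F G fun t => by
    by_cases ht : ∃ a b, r a b ∧ F a = t
    · obtain ⟨a, b, hab, rfl⟩ := ht
      -- All parts in a block have the same size and `f` preserves the blocks, so dividing the
      -- vertex counts equates the numbers of parts.
      have h1 := ncard_preimage_eq_mul c hc {a' | F a' = F a} (m := {y | d y = b}.ncard) (by
        intro a' ha'
        refine hcard a' b ?_
        have : b ∈ F a := hab
        rwa [← show F a' = F a from ha'] at this)
      have h2 := ncard_preimage_eq_mul d hd {b' | G b' = F a} (m := {y | d y = b}.ncard) (by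
        intro b' hb'
        rw [← hcard a b hab]
        refine (hcard a b' ?_).symm
        obtain ⟨a', ha'⟩ := hβ b'
        have : b' ∈ G b' := ⟨a', ha', ha'⟩
        rwa [show G b' = F a from hb'] at this)
      have h3 : {x | c x ∈ {a' | F a' = F a}}.ncard = {y | d y ∈ {b' | G b' = F a}}.ncard := by
        rw [← Set.ncard_image_of_injective _ f.injective]
        congr 1
        ext y
        rw [Equiv.image_eq_preimage_symm]
        have := hFG _ _ (hf (f.symm y))
        rw [Equiv.apply_symm_apply] at this
        change F _ = F a ↔ G _ = F a
        rw [this]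
      have hpos : 0 < {y | d y = b}.ncard := by
        obtain ⟨y, hy⟩ := hd b
        exact (Set.ncard_pos (Set.toFinite _)).2 ⟨y, hy⟩
      rw [h1, h2] at h3
      exact Nat.eq_of_mul_eq_mul_right hpos h3
    · push Not at ht
      have h1 : {a | F a = t} = ∅ := Set.eq_empty_of_forall_notMem fun a ha => by
        obtain ⟨b, hb⟩ := hα a
        exact ht a b hb ha
      have h2 : {b | G b = t} = ∅ := Set.eq_empty_of_forall_notMem fun b hb => by
        obtain ⟨a, ha⟩ := hβ b
        exact ht a b ha ((hFG a b ha).trans hb)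
      rw [h1, h2, Set.ncard_empty, Set.ncard_empty]
  refine ⟨π, fun a => ?_⟩
  obtain ⟨a', ha'⟩ := hβ (π a)
  have : π a ∈ G (π a) := ⟨a', ha', ha'⟩
  rwa [hπ a] at this

end Matching

/-! ### Exploring a component with few pebbles -/

namespace PebbledGraph

variable {C : Type w} {V : Type u} {W : Type v} {k s L : ℕ}
variable {M : PebbledGraph C V k s} {N : PebbledGraph C W k s}

/-- Placing several further pebbles. -/
lemma Sim.extend [Finite V] [Finite W] (hs : 0 < s) {g : V → W} {S : Set V}
    (h : M.Sim N ((fun x => (x, g x)) '' S)) (T : Set V) (hST : Disjoint S T)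
    (hk : s + S.ncard + T.ncard ≤ k) :
    ∃ g' : V → W, (∀ x, x ∉ T → g' x = g x) ∧ M.Sim N ((fun x => (x, g' x)) '' (S ∪ T)) := by
  classical
  induction T, T.toFinite using Set.Finite.induction_on with
  | empty => exact ⟨g, fun _ _ => rfl, by simpa using h⟩
  | @insert a T ha hT ih =>
    rw [Set.ncard_insert_of_notMem ha hT] at hk
    rw [Set.disjoint_insert_right] at hST
    obtain ⟨g', hg, hsim⟩ := ih hST.2 (by omega)
    have hcard : ((fun x => (x, g' x)) '' (S ∪ T)).ncard ≤ S.ncard + T.ncard :=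
      (Set.ncard_image_le (Set.toFinite _)).trans (Set.ncard_union_le _ _)
    obtain ⟨y, hy⟩ := hsim.exists_pair hs (by omega) a
    refine ⟨Function.update g' a y, fun x hx => ?_, hy.mono ?_⟩
    · rw [Set.mem_insert_iff, not_or] at hx
      rw [Function.update_of_ne hx.1, hg x hx.2]
    · rintro _ ⟨x, hx, rfl⟩
      by_cases hxa : x = a
      · subst hxa; simp
      · refine Or.inr ⟨x, ?_, by simp [hxa]⟩
        rcases hx with hx | hx | hx
        · exact Or.inl hx
        · exact absurd hx hxa
        · exact Or.inr hx

lemma Sim₂.eq_iff {x y : V} {x' y' : W} (h : M.Sim₂ N x y x' y') (hk : 1 < k) :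
    x = y ↔ x' = y' :=
  (Sim.atoms h hk (by simp) (by simp)).1

/-- The links that leave a set of fibers. -/
def out (M : PebbledGraph C V k s) (Q : Set (Set V)) : Set (Set V × Set V) :=
  {z | z.1 ∈ Q ∧ z.2 ∉ Q ∧ M.Link z.1 z.2}

/-- The vertices of the component of `x₀` in fibers of `Q` that are linked to other fibers. -/
def boundary (M : PebbledGraph C V k s) (x₀ : V) (Q : Set (Set V)) : Set V :=
  {x | x ∈ M.comp x₀ ∧ M.fiber x ∈ Q ∧ ∃ Y, Y ∉ Q ∧ M.Link (M.fiber x) Y}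

/-- There is a type preserving map on the vertices of the component of `x₀` in fibers of `Q`. -/
def Explored (M : PebbledGraph C V k s) (N : PebbledGraph C W k s) (x₀ : V) (y₀ : W)
    (Q : Set (Set V)) : Prop :=
  M.fiber x₀ ∈ Q ∧ (M.out Q).ncard ≤ 2 ∧ ∃ g : V → W, g x₀ = y₀ ∧
    M.Sim N ((fun x => (x, g x)) '' M.boundary x₀ Q) ∧
    ∀ x ∈ M.comp x₀, ∀ y ∈ M.comp x₀, M.fiber x ∈ Q → M.fiber y ∈ Q →
      (M.fiber x = M.fiber y ∨ M.Link (M.fiber x) (M.fiber y)) → M.Sim₂ N x y (g x) (g y)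

section Explore

variable [Fintype V] [Finite W]

lemma Terminal.ncard_comp_inter_le (hM : M.Terminal L) (x : V) (X : Set V) :
    (M.comp x ∩ {y | M.fiber y = X}).ncard ≤ (18 * L + 1) ^ 12 := by
  rcases Set.eq_empty_or_nonempty (M.comp x ∩ {y | M.fiber y = X}) with h | ⟨z, -, hz⟩
  · simp [h]
  have hz' : M.fiber z = X := hz
  subst hz'
  refine le_trans (Set.ncard_le_ncard ?_) (hM.ncard_comp_inter_fiber_le x z)
  exact Set.inter_subset_inter_right _ fun y hy => fiber_eq_iff.1 (Eq.symm hy)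

lemma Terminal.ncard_boundary_le (hM : M.Terminal L) {x₀ : V} {Q : Set (Set V)}
    (hQ : (M.out Q).ncard ≤ 2) : (M.boundary x₀ Q).ncard ≤ 2 * (18 * L + 1) ^ 12 := by
  refine (Set.ncard_le_ncard ?_).trans (ncard_biUnion_le
    (fun z : Set V × Set V => M.comp x₀ ∩ {y | M.fiber y = z.1}) hQ
    fun z _ => hM.ncard_comp_inter_le x₀ z.1)
  rintro x ⟨hx, hxQ, Y, hY, hl⟩
  exact Set.mem_biUnion (show (M.fiber x, Y) ∈ M.out Q from ⟨hxQ, hY, hl⟩) ⟨hx, rfl⟩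

/-- Absorbing `Y` removes the outgoing link from `X` to `Y` and adds at most one, as one of the at
most two links of `Y` leads back to `X`. -/
lemma Terminal.ncard_out_insert_le (hM : M.Terminal L) {Q : Set (Set V)} {X Y : Set V}
    (hX : X ∈ Q) (hY : Y ∉ Q) (hXY : M.Link X Y) (hQ : (M.out Q).ncard ≤ 2) :
    (M.out (insert Y Q)).ncard ≤ 2 := by
  have hs := hM.pos
  have hk := hM.room
  have hXY' : (X, Y) ∈ M.out Q := ⟨hX, hY, hXY⟩
  have hsub : M.out (insert Y Q) ⊆
      (M.out Q \ {(X, Y)}) ∪ (fun Z => (Y, Z)) '' ({Z | M.Link Y Z} \ {X}) := by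
    rintro ⟨A, B⟩ ⟨hA, hB, hl⟩
    simp only [Set.mem_insert_iff, not_or] at hA hB hl
    rcases hA with rfl | hA
    · refine Or.inr ⟨B, ⟨hl, ?_⟩, rfl⟩
      rintro rfl
      exact hB.2 hX
    · refine Or.inl ⟨⟨hA, hB.2, hl⟩, fun h => hB.1 ?_⟩
      exact (Prod.ext_iff.1 h).2
  have h1 := (Set.ncard_le_ncard hsub).trans (Set.ncard_union_le _ _)
  have h2 := Set.ncard_sdiff_singleton_of_mem hXY'
  have h3 := Set.ncard_sdiff_singleton_of_mem
    (show X ∈ {Z | M.Link Y Z} from hXY.symm hs (by omega))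
  have h4 := hM.ncard_link_le Y
  have h5 := Set.ncard_image_le (f := fun Z => (Y, Z)) (Set.toFinite ({Z | M.Link Y Z} \ {X}))
  have h6 : 0 < (M.out Q).ncard := (Set.ncard_pos (Set.toFinite _)).2 ⟨_, hXY'⟩
  omega

lemma Terminal.explored_singleton (hM : M.Terminal L) {x₀ : V} {y₀ : W}
    (h : M.Sim₁ N x₀ y₀) (hk : s + 1 + (18 * L + 1) ^ 12 ≤ k) :
    M.Explored N x₀ y₀ {M.fiber x₀} := by
  refine ⟨rfl, ?_, ?_⟩
  · refine le_trans ?_ (hM.ncard_link_le (M.fiber x₀))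
    refine (Set.ncard_le_ncard (t := (fun Z => (M.fiber x₀, Z)) '' {Z | M.Link (M.fiber x₀) Z})
      ?_).trans (Set.ncard_image_le (Set.toFinite _))
    rintro ⟨A, B⟩ ⟨hA, hB, hl⟩
    have hA' : A = M.fiber x₀ := hA
    subst hA'
    exact ⟨B, hl, rfl⟩
  · have hsim : M.Sim N ((fun x => (x, (fun _ => y₀ : V → W) x)) '' {x₀}) := by
      rw [Set.image_singleton]; exact h
    have hT : ((M.comp x₀ ∩ {y | M.fiber y = M.fiber x₀}) \ {x₀}).ncard ≤ (18 * L + 1) ^ 12 :=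
      (Set.ncard_le_ncard Set.sdiff_subset).trans (hM.ncard_comp_inter_le x₀ _)
    obtain ⟨g, hg, hgs⟩ := hsim.extend hM.pos
      ((M.comp x₀ ∩ {y | M.fiber y = M.fiber x₀}) \ {x₀}) Set.disjoint_sdiff_right
      (by rw [Set.ncard_singleton]; omega)
    have hmem : ∀ x ∈ M.comp x₀, M.fiber x ∈ ({M.fiber x₀} : Set (Set V)) →
        x ∈ {x₀} ∪ ((M.comp x₀ ∩ {y | M.fiber y = M.fiber x₀}) \ {x₀}) := by
      intro x hx hx'
      by_cases hxx : x = x₀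
      · exact Or.inl hxx
      · exact Or.inr ⟨⟨hx, hx'⟩, hxx⟩
    refine ⟨g, hg x₀ (by simp), hgs.mono (Set.image_mono fun x hx => hmem x hx.1 hx.2.1), ?_⟩
    intro x hx y hy hxQ hyQ _
    refine hgs.mono ?_
    rintro _ (rfl | rfl)
    · exact ⟨x, hmem x hx hxQ, rfl⟩
    · exact ⟨y, hmem y hy hyQ, rfl⟩

/-- The boundary separates the explored fibers from the rest, so interior pebbles may be lifted. At
most two portions of fibers stay pebbled and a third is added, whence the factor 3. -/
lemma Terminal.explored_insert (hM : M.Terminal L) {x₀ : V} {y₀ : W} {Q : Set (Set V)}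
    (hQ : M.Explored N x₀ y₀ Q) {X Y : Set V} (hX : X ∈ Q) (hY : Y ∉ Q) (hXY : M.Link X Y)
    (hk : s + 3 * (18 * L + 1) ^ 12 ≤ k) : M.Explored N x₀ y₀ (insert Y Q) := by
  have hs := hM.pos
  have hk' := hM.room
  obtain ⟨hx₀, hout, g, hg₀, hsim, hpair⟩ := hQ
  let T := M.comp x₀ ∩ {y | M.fiber y = Y}
  have hT : T.ncard ≤ (18 * L + 1) ^ 12 := hM.ncard_comp_inter_le x₀ Y
  have hdisj : Disjoint (M.boundary x₀ Q) T := by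
    rw [Set.disjoint_left]
    rintro x ⟨-, hx, -⟩ ⟨-, hx'⟩
    exact hY ((show M.fiber x = Y from hx') ▸ hx)
  obtain ⟨g', hg', hsim'⟩ := hsim.extend hs T hdisj (by
    have := hM.ncard_boundary_le (x₀ := x₀) hout
    omega)
  have hold : ∀ x, M.fiber x ∈ Q → g' x = g x := fun x hx =>
    hg' x fun hxT => hY ((show M.fiber x = Y from hxT.2) ▸ hx)
  have hmem : ∀ x ∈ M.comp x₀, ∀ y ∈ M.comp x₀, M.fiber x ∈ insert Y Q → M.fiber y = Y →
      (M.fiber x = M.fiber y ∨ M.Link (M.fiber x) (M.fiber y)) →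
      M.Sim₂ N x y (g' x) (g' y) := by
    intro x hx y hy hxQ hyY hl
    -- An old vertex whose fiber is linked to `Y` is on the boundary, so it is still pebbled when
    -- the vertices of `T` receive their images.
    have hxm : x ∈ M.boundary x₀ Q ∪ T := by
      rcases hxQ with hxY | hxQ
      · exact Or.inr ⟨hx, hxY⟩
      · refine Or.inl ⟨hx, hxQ, Y, hY, ?_⟩
        rw [hyY] at hl
        rcases hl with h | h
        · exact absurd (h ▸ hxQ) hY
        · exact h
    refine hsim'.mono ?_
    rintro _ (rfl | rfl)
    · exact ⟨x, hxm, rfl⟩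
    · exact ⟨y, Or.inr ⟨hy, hyY⟩, rfl⟩
  refine ⟨Or.inr hx₀, hM.ncard_out_insert_le hX hY hXY hout, g', (hold x₀ hx₀).trans hg₀,
    hsim'.mono (Set.image_mono ?_), ?_⟩
  · rintro x ⟨hx, hxQ, Z, hZ, hl⟩
    rcases hxQ with hxY | hxQ
    · exact Or.inr ⟨hx, hxY⟩
    · exact Or.inl ⟨hx, hxQ, Z, fun h => hZ (Or.inr h), hl⟩
  · intro x hx y hy hxQ hyQ hl
    rcases hyQ with hyY | hyQ
    · exact hmem x hx y hy hxQ hyY hl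
    · rcases hxQ with hxY | hxQ
      · exact (hmem y hy x hx (Or.inr hyQ) hxY
          (hl.imp Eq.symm fun h => h.symm hs (by omega))).swap
      · rw [hold x hxQ, hold y hyQ]
        exact hpair x hx y hy hxQ hyQ hl

/-- Vertices of the same type have isomorphic components. -/
lemma Terminal.exists_map (hM : M.Terminal L) {x₀ : V} {y₀ : W} (h : M.Sim₁ N x₀ y₀)
    (hk : s + 3 * (18 * L + 1) ^ 12 ≤ k) : ∃ g : V → W, g x₀ = y₀ ∧
      ∀ x ∈ M.comp x₀, ∀ y ∈ M.comp x₀, M.Sim₂ N x y (g x) (g y) := by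
  have hs := hM.pos
  have hk' := hM.room
  have hpow : 1 ≤ (18 * L + 1) ^ 12 := Nat.one_le_pow _ _ (by omega)
  obtain ⟨Q, -, hQ, hmax⟩ := Finite.exists_le_maximal
    (hM.explored_singleton h (by omega))
  have hclosed : ∀ X ∈ Q, ∀ Y, M.Link X Y → Y ∈ Q := by
    intro X hX Y hXY
    by_contra hY
    exact hY (hmax (hM.explored_insert hQ hX hY hXY hk) (Set.subset_insert Y Q)
      (Set.mem_insert Y Q))
  obtain ⟨hx₀, -, g, hg₀, -, hpair⟩ := hQ
  have hlink : ∀ x y, M.Exc x y → M.fiber x = M.fiber y ∨ M.Link (M.fiber x) (M.fiber y) := by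
    intro x y hxy
    by_cases he : M.fiber x = M.fiber y
    · exact Or.inl he
    · exact Or.inr ⟨he, x, y, rfl, rfl, hxy⟩
  have hall : M.comp x₀ ⊆ {x | M.fiber x ∈ Q} := by
    refine comp_subset_of_closed hx₀ fun x hx y hxy => ?_
    rcases hlink x y hxy with he | hl
    · exact (show M.fiber y ∈ Q from he ▸ hx)
    · exact hclosed _ hx _ hl
  refine ⟨g, hg₀, fun x hx y hy => ?_⟩
  by_cases hl : M.fiber x = M.fiber y ∨ M.Link (M.fiber x) (M.fiber y)
  · exact hpair x hx y hy (hall hx) (hall hy) hl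
  have h1 := (hpair x hx x hx (hall hx) (hall hx) (Or.inl rfl)).left
  have h2 := (hpair y hy y hy (hall hy) (hall hy) (Or.inl rfl)).left
  refine sim₂_of_not_exc h1 h2 (fun he => hl (hlink x y he)) (fun he => hl ?_) hs (by omega)
  -- An exceptional pair in `N` pulls back to one from `x` into the fiber of `y`, which contradicts
  -- the missing link.
  obtain ⟨y', hy'⟩ := h1.symm.exists_sim₂ hs (by omega) (g y)
  rw [fiber_eq_iff.2 (h2.trans hy'.right)]
  exact hlink x y' ((hy'.exc_iff hs (by omega)).1 he)

end Explore

/-- The vertices `x` and `g x` have equally many exceptional partners, so the injective `g` reaches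
all partners of `g x` and its image is closed under exceptional pairs. -/
lemma image_comp_eq [Finite V] [Finite W] (hs : 0 < s) (hk : s + 1 < k) {g : V → W} {x₀ : V}
    (hg : ∀ x ∈ M.comp x₀, ∀ y ∈ M.comp x₀, M.Sim₂ N x y (g x) (g y)) :
    g '' M.comp x₀ = N.comp (g x₀) := by
  refine Set.Subset.antisymm ?_ (comp_subset_of_closed ⟨x₀, mem_comp_self x₀, rfl⟩ ?_)
  · rw [Set.image_subset_iff]
    have : M.comp x₀ ⊆ M.comp x₀ ∩ g ⁻¹' N.comp (g x₀) := by
      refine comp_subset_of_closed ⟨mem_comp_self x₀, mem_comp_self (g x₀)⟩ fun y hy z hyz => ?_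
      have hz := mem_comp_of_exc hy.1 hyz
      exact ⟨hz, mem_comp_of_exc hy.2 (((hg y hy.1 z hz).exc_iff hs hk).1 hyz)⟩
    exact this.trans Set.inter_subset_right
  · rintro _ ⟨x, hx, rfl⟩ y hy
    obtain ⟨f, hf⟩ := (hg x hx x hx).left.exists_equiv hs hk
    have hcomp : {z | M.Exc x z} ⊆ M.comp x₀ := fun z hz => mem_comp_of_exc hx hz
    have h1 : g '' {z | M.Exc x z} ⊆ {z | N.Exc (g x) z} := by
      rintro _ ⟨z, hz, rfl⟩
      exact ((hg x hx z (hcomp hz)).exc_iff hs hk).1 hz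
    have h2 : {z | N.Exc (g x) z} = f '' {z | M.Exc x z} := by
      ext z
      rw [Equiv.image_eq_preimage_symm]
      have := (hf (f.symm z)).exc_iff hs hk
      rw [Equiv.apply_symm_apply] at this
      exact this.symm
    have h3 : (g '' {z | M.Exc x z}).ncard = {z | M.Exc x z}.ncard := by
      refine Set.InjOn.ncard_image fun a ha b hb hab => ?_
      exact ((hg a (hcomp ha) b (hcomp hb)).eq_iff (by omega)).2 hab
    have h4 := Set.eq_of_subset_of_ncard_le h1 (by
      rw [h3, h2, Set.ncard_image_of_injective _ f.injective])
    have : y ∈ {z | N.Exc (g x) z} := hy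
    rw [← h4] at this
    exact Set.image_mono hcomp this

/-- If no further pebble gains much, then equivalent graphs are isomorphic. -/
theorem Terminal.exists_equiv [Fintype V] [Finite W] (hM : M.Terminal L) (h : M.Sim N ∅)
    (hk : s + 3 * (18 * L + 1) ^ 12 ≤ k) :
    ∃ e : V ≃ W, ∀ x y, M.Sim₂ N x y (e x) (e y) := by
  classical
  have hs := hM.pos
  have hk' := hM.room
  obtain ⟨f, hf⟩ := exists_equiv_sim₁ h hs (by omega)
  -- The relation holds between components that are isomorphic with respect to pair types. It is
  -- difunctional because such maps compose and can be inverted.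
  let r : Set.range M.comp → Set.range N.comp → Prop := fun K K' =>
    ∃ g : V → W, (∀ x ∈ K.1, ∀ y ∈ K.1, M.Sim₂ N x y (g x) (g y)) ∧ g '' K.1 = K'.1
  have hinj : ∀ {K : Set V} {g : V → W}, (∀ x ∈ K, ∀ y ∈ K, M.Sim₂ N x y (g x) (g y)) →
      Set.InjOn g K := fun hg x hx y hy hxy => ((hg x hx y hy).eq_iff (by omega)).2 hxy
  have hMc : ∀ (K : Set.range M.comp) (x : V),
      Set.rangeFactorization M.comp x = K ↔ x ∈ K.1 := by
    rintro ⟨_, z, rfl⟩ x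
    rw [Subtype.ext_iff]
    exact ⟨fun h => (show _ = _ from h) ▸ mem_comp_self x,
      fun h => comp_eq_of_mem hs (by omega) h⟩
  have hNc : ∀ (K : Set.range N.comp) (x : W),
      Set.rangeFactorization N.comp x = K ↔ x ∈ K.1 := by
    rintro ⟨_, z, rfl⟩ x
    rw [Subtype.ext_iff]
    exact ⟨fun h => (show _ = _ from h) ▸ mem_comp_self x,
      fun h => comp_eq_of_mem hs (by omega) h⟩
  have hr : ∀ K₁ K₂ K₃ K₄, r K₁ K₂ → r K₃ K₂ → r K₃ K₄ → r K₁ K₄ := by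
    rintro K₁ K₂ K₃ K₄ ⟨g₁, h1, i1⟩ ⟨g₂, h2, i2⟩ ⟨g₃, h3, i3⟩
    have : ∀ x, ∃ z, x ∈ K₁.1 → z ∈ K₃.1 ∧ g₂ z = g₁ x := by
      intro x
      by_cases hx : x ∈ K₁.1
      · have : g₁ x ∈ g₂ '' K₃.1 := by rw [i2, ← i1]; exact ⟨x, hx, rfl⟩
        obtain ⟨z, hz⟩ := this
        exact ⟨z, fun _ => hz⟩
      · exact ⟨x, fun h => absurd h hx⟩
    choose z hz using this
    refine ⟨g₃ ∘ z, fun x hx y hy => ?_, ?_⟩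
    · obtain ⟨hx1, hx2⟩ := hz x hx
      obtain ⟨hy1, hy2⟩ := hz y hy
      have h2' := h2 _ hx1 _ hy1
      rw [hx2, hy2] at h2'
      exact ((h1 x hx y hy).trans h2'.symm).trans (h3 _ hx1 _ hy1)
    · rw [← i3, Set.image_comp]
      congr 1
      ext t
      constructor
      · rintro ⟨x, hx, rfl⟩
        exact (hz x hx).1
      · intro ht
        have : g₂ t ∈ g₁ '' K₁.1 := by rw [i1, ← i2]; exact ⟨t, ht, rfl⟩
        obtain ⟨x, hx, hxt⟩ := this
        exact ⟨x, hx, hinj h2 (hz x hx).1 ht ((hz x hx).2.trans hxt)⟩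
  have hcard : ∀ K K', r K K' → {x | Set.rangeFactorization M.comp x = K}.ncard =
      {y | Set.rangeFactorization N.comp y = K'}.ncard := by
    rintro K K' ⟨g, hg, hgi⟩
    have e1 : {x | Set.rangeFactorization M.comp x = K} = K.1 := Set.ext fun x => hMc K x
    have e2 : {x | Set.rangeFactorization N.comp x = K'} = K'.1 := Set.ext fun x => hNc K' x
    rw [e1, e2, ← hgi, (hinj hg).ncard_image]
  have hrf : ∀ x, r (Set.rangeFactorization M.comp x) (Set.rangeFactorization N.comp (f x)) := by
    intro x
    obtain ⟨g, hg₀, hg⟩ := hM.exists_map (hf x) hk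
    refine ⟨g, hg, ?_⟩
    rw [← hg₀]
    exact image_comp_eq hs (by omega) hg
  obtain ⟨π, hπ⟩ := exists_equiv_of_difunctional (Set.rangeFactorization M.comp)
    (Set.rangeFactorization N.comp) Set.rangeFactorization_surjective
    Set.rangeFactorization_surjective r hr hcard f hrf
  choose g hg hgi using hπ
  let c := Set.rangeFactorization M.comp
  have hc : ∀ x, x ∈ (c x).1 := mem_comp_self
  let e : V → W := fun x => g (c x) x
  have hec : ∀ x, Set.rangeFactorization N.comp (e x) = π (c x) := by
    intro x
    rw [hNc, ← hgi]
    exact ⟨x, hc x, rfl⟩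
  have hsim : ∀ x y, c x = c y → M.Sim₂ N x y (e x) (e y) := by
    intro x y hxy
    have := hg (c x) x (hc x) y (hxy ▸ hc y)
    simp only [e, ← hxy]
    exact this
  have he : Function.Injective e := by
    intro x y hxy
    have hcxy : c x = c y := π.injective (by rw [← hec, ← hec, hxy])
    exact ((hsim x y hcxy).eq_iff (by omega)).2 hxy
  have hVW : Nat.card V = Nat.card W := Nat.card_congr f
  refine ⟨Equiv.ofBijective e (he.bijective_of_nat_card_le hVW.ge), fun x y => ?_⟩
  change M.Sim₂ N x y (e x) (e y)
  by_cases hxy : c x = c y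
  · exact hsim x y hxy
  -- Vertices in different components form an unexceptional pair on both sides, because `π` is
  -- injective.
  refine sim₂_of_not_exc (hsim x x rfl).left (hsim y y rfl).left (fun hx => hxy ?_)
    (fun hx => hxy (π.injective ?_)) hs (by omega)
  · exact ((hMc _ _).2 (mem_comp_of_exc (hc x) hx)).symm
  · rw [← hec, ← hec]
    exact ((hNc _ _).2 (mem_comp_of_exc (mem_comp_self (e x)) hx)).symm

end PebbledGraph

/-- The number of variables that suffice for `n` vertices, for a parameter `L`. -/
def numVars (L n : ℕ) : ℕ := n * (L + 3) / (4 * L) + (3 * (18 * L + 1) ^ 12 + 4)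

lemma numVars_pos (L n : ℕ) : 0 < numVars L n :=
  lt_of_lt_of_le (by norm_num : 0 < 4) ((Nat.le_add_left _ _).trans (Nat.le_add_left _ _))

namespace PebbledGraph

variable {C : Type w} {V : Type u} {W : Type v} {k : ℕ}

open Classical in
/-- Pebbles can be placed until no further pebble gains much potential. -/
lemma exists_terminal [Fintype V] [Finite W] {L : ℕ} (hL : 0 < L)
    (hk : numVars L (Fintype.card V) ≤ k) (d s : ℕ)
    (hd : s + d = Fintype.card V * (L + 3) / (4 * L) + 2) (hs : 0 < s)
    (M : PebbledGraph C V k s) (N : PebbledGraph C W k s) (hMN : M.Sim N ∅)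
    (hpot : 4 * L * (s - 1) ≤ potential L M.fiber) :
    ∃ (s' : ℕ) (M' : PebbledGraph C V k s') (N' : PebbledGraph C W k s'),
      s' + 3 * (18 * L + 1) ^ 12 ≤ k ∧ M'.Terminal L ∧ M'.Sim N' ∅ ∧
      M'.graph = M.graph ∧ M'.col = M.col ∧ N'.graph = N.graph ∧ N'.col = N.col := by
  have hpow : 1 ≤ (18 * L + 1) ^ 12 := Nat.one_le_pow _ _ (by omega)
  -- The first pebble is placed without any claimed gain, so only `s - 1` pebbles are charged `4 *
  -- L`; `d` is the fuel left under this bound.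
  have hs' : s - 1 ≤ Fintype.card V * (L + 3) / (4 * L) := by
    rw [Nat.le_div_iff_mul_le (by omega), mul_comm]
    exact hpot.trans (potential_le L _)
  unfold numVars at hk
  induction d generalizing s with
  | zero => omega
  | succ d ih =>
    by_cases hT : ∀ x, potential L (cons x M).fiber < potential L M.fiber + 4 * L
    · exact ⟨s, M, N, by omega, ⟨hs, by omega, hT⟩, hMN, rfl, rfl, rfl, rfl⟩
    · push Not at hT
      obtain ⟨x, hx⟩ := hT
      obtain ⟨y, hy⟩ := hMN.exists_pair hs (by rw [Set.ncard_empty]; omega) x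
      have hpot' : 4 * L * (s + 1 - 1) ≤ potential L (cons x M).fiber := by
        obtain ⟨t, rfl⟩ : ∃ t, s = t + 1 := ⟨s - 1, by omega⟩
        simp only [Nat.add_sub_cancel] at hpot ⊢
        refine le_trans ?_ hx
        rw [mul_add]
        omega
      refine ih (s + 1) (by omega) (by omega) (cons x M) (cons y N) (sim_cons.2 hy) hpot' ?_
      rw [Nat.le_div_iff_mul_le (by omega), mul_comm]
      exact hpot'.trans (potential_le L _)

end PebbledGraph

/-! ### From indistinguishability to defining sentences -/

section Definability

variable {C : Type w} {V : Type u} {W : Type v} {k : ℕ}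

/-- Graphs that satisfy the same sentences with sufficiently many variables are isomorphic. -/
theorem exists_iso_of_sentences [Fintype V] [Nonempty V] [Finite W] [Nonempty W] {L : ℕ}
    (hL : 0 < L) (hk : numVars L (Fintype.card V) ≤ k) (G : SimpleGraph V) (P : C → Set V)
    (H : SimpleGraph W) (Q : C → Set W)
    (h : ∀ φ : CFormula C k, φ.IsSentence → (∀ a, φ.Realize G P a) → ∀ b, φ.Realize H Q b) :
    ∃ e : V ≃ W, (∀ x y, G.Adj x y ↔ H.Adj (e x) (e y)) ∧ ∀ c x, x ∈ P c ↔ e x ∈ Q c := by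
  obtain ⟨x₀⟩ := ‹Nonempty V›
  obtain ⟨y₀, hy₀⟩ := CFormula.exists_theory_const_eq
    ((numVars_pos _ _).trans_le hk) h x₀
  let M : PebbledGraph C V k 1 := ⟨G, P, fun _ => x₀⟩
  let N : PebbledGraph C W k 1 := ⟨H, Q, fun _ => y₀⟩
  have hMN : M.Sim N ∅ := by
    intro a ha
    have : a = fun _ => (x₀, y₀) := by
      funext i
      rcases ha i with h | ⟨j, h⟩
      · exact h.elim
      · exact h
    subst this
    exact hy₀
  obtain ⟨s, M', N', hs, hT, hsim, hG, hP, hH, hQ⟩ := PebbledGraph.exists_terminal hL hk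
    (Fintype.card V * (L + 3) / (4 * L) + 1) 1 (by omega) one_pos M N hMN (by simp)
  obtain ⟨e, he⟩ := hT.exists_equiv hsim hs
  have hk1 : 1 < k := by have := hT.room; omega
  refine ⟨e, fun x y => ?_, fun c x => ?_⟩
  · have := (PebbledGraph.Sim.atoms (he x y) hk1 (x := x) (y := y) (x' := e x) (y' := e y)
      (by simp) (by simp)).2.1
    rwa [hG, hH] at this
  · have := (PebbledGraph.Sim.atoms (he x x) hk1 (x := x) (y := x) (x' := e x) (y' := e x)
      (by simp) (by simp)).2.2 c
    rwa [hP, hQ] at this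

/-- The sentence stating that there are exactly `n` vertices. -/
def cardSentence (C : Type w) (i : Fin k) (n : ℕ) : CFormula C k :=
  CFormula.conj [.atLeast n i (.conj []), .neg (.atLeast (n + 1) i (.conj []))]

lemma isSentence_cardSentence (i : Fin k) (n : ℕ) : (cardSentence C i n).IsSentence := by
  refine CFormula.isSentence_conj fun φ hφ => ?_
  have : (CFormula.conj [] : CFormula C k).freeVars = ∅ := rfl
  simp only [List.mem_cons, List.not_mem_nil, or_false] at hφ
  rcases hφ with rfl | rfl
  · simp [CFormula.IsSentence, CFormula.freeVars, this]
  · apply CFormula.isSentence_neg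
    simp [CFormula.IsSentence, CFormula.freeVars, this]

lemma realize_cardSentence [Finite W] (i : Fin k) (n : ℕ) (H : SimpleGraph W) (Q : C → Set W)
    (a : Fin k → W) : (cardSentence C i n).Realize H Q a ↔ Nat.card W = n := by
  have : {x : W | (CFormula.conj [] : CFormula C k).Realize H Q (Function.update a i x)} =
      Set.univ := by
    ext; simp
  have h : ∀ m, (CFormula.atLeast m i (.conj [])).Realize H Q a ↔ m ≤ Nat.card W := fun m => by
    rw [CFormula.realize_atLeast, this, Set.ncard_univ]
  simp only [cardSentence, CFormula.realize_conj, List.mem_cons, List.not_mem_nil, or_false,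
    forall_eq_or_imp, forall_eq, CFormula.realize_neg, h]
  omega

/-- A sentence that defines a graph among those that use finitely many given colors only. -/
theorem exists_defining_sentence [Fintype V] [Nonempty V] {L : ℕ} (hL : 0 < L)
    (hk : numVars L (Fintype.card V) ≤ k) (G : SimpleGraph V) (P : C → Set V) (D : Finset C) :
    ∃ φ : CFormula C k, φ.IsSentence ∧ ∀ (W : Type v) [Finite W] [Nonempty W]
      (H : SimpleGraph W) (Q : C → Set W), (∀ c ∉ D, Q c = ∅) →
      ((∀ a, φ.Realize H Q a) ↔
        ∃ e : W ≃ V, (∀ x y, H.Adj x y ↔ G.Adj (e x) (e y)) ∧ ∀ c x, x ∈ Q c ↔ e x ∈ P c) := by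
  classical
  let n := Fintype.card V
  have hn : 0 < n := Fintype.card_pos
  have : Nonempty (Fin n) := ⟨⟨0, hn⟩⟩
  have hk0 : 0 < k := (numVars_pos _ _).trans_le hk
  let Z := SimpleGraph (Fin n) × (D → Set (Fin n))
  cases nonempty_fintype Z
  -- Restricting to the finitely many colors of `D` makes `Z` finite even if `C` is infinite; all
  -- other color classes are empty.
  let R : Z → C → Set (Fin n) := fun z c => {x | ∃ h : c ∈ D, x ∈ z.2 ⟨c, h⟩}
  have key : ∀ z : Z, ∃ φ : CFormula C k, φ.IsSentence ∧ (∀ a, φ.Realize G P a) ∧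
      ((∀ a, φ.Realize z.1 (R z) a) → ∃ e : V ≃ Fin n,
        (∀ x y, G.Adj x y ↔ z.1.Adj (e x) (e y)) ∧ ∀ c x, x ∈ P c ↔ e x ∈ R z c) := by
    intro z
    by_contra! hcon
    have hiso := exists_iso_of_sentences hL hk G P z.1 (R z)
      fun φ h1 h2 => (hcon φ h1 h2).1
    obtain ⟨e, he1, he2⟩ := hiso
    -- A trivially true sentence is inserted only to extract the failure of isomorphism from `hcon`.
    obtain ⟨c, x, hcx⟩ := (hcon (.conj []) rfl (by simp)).2 e he1
    have := he2 c x
    tauto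
  choose ψ h1 h2 h3 using key
  let φ : CFormula C k := .conj (cardSentence C ⟨0, hk0⟩ n :: Finset.univ.toList.map ψ)
  have hφ : ∀ {U : Type v} (H : SimpleGraph U) (Q : C → Set U) (a : Fin k → U),
      φ.Realize H Q a ↔ (cardSentence C ⟨0, hk0⟩ n).Realize H Q a ∧
        ∀ z, (ψ z).Realize H Q a := by
    intro U H Q a
    simp [φ]
  refine ⟨φ, ?_, ?_⟩
  · refine CFormula.isSentence_conj fun χ hχ => ?_
    simp only [List.mem_cons, List.mem_map, Finset.mem_toList, Finset.mem_univ, true_and] at hχ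
    rcases hχ with rfl | ⟨z, rfl⟩
    · exact isSentence_cardSentence _ _
    · exact h1 z
  · intro W _ _ H Q hQ
    constructor
    · intro h
      obtain ⟨w₀⟩ := ‹Nonempty W›
      have hcard : Nat.card W = n := by
        have := ((hφ H Q _).1 (h fun _ => w₀)).1
        rwa [realize_cardSentence] at this
      let f : W ≃ Fin n := Finite.equivFinOfCardEq hcard
      let z : Z := (H.comap f.symm, fun c => f.symm ⁻¹' Q c)
      have hR : R z = fun c => f.symm ⁻¹' Q c := by
        funext c
        ext x
        by_cases hc : c ∈ D
        · simp [R, z, hc]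
        · simp [R, hc, hQ c hc]
      obtain ⟨e, he1, he2⟩ := h3 z fun a => by
        have := ((hφ H Q _).1 (h (f.symm ∘ a))).2 z
        rw [CFormula.realize_iff_of_iso (H := z.1) (Q := R z) f (by simp [z])
          (by simp [hR])] at this
        simpa [← Function.comp_assoc] using this
      refine ⟨f.trans e.symm, fun x y => ?_, fun c x => ?_⟩
      · rw [he1]; simp [z]
      · rw [he2, hR]; simp
    · rintro ⟨e, he1, he2⟩ a
      rw [hφ]
      refine ⟨?_, fun z => ?_⟩
      · rw [realize_cardSentence, Nat.card_congr e, Nat.card_eq_fintype_card]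
      · rw [CFormula.realize_iff_of_iso e he1 he2]
        exact h2 z _

theorem definableInC [Fintype V] [Nonempty V] {L : ℕ} (hL : 0 < L)
    (hk : numVars L (Fintype.card V) ≤ k) (G : SimpleGraph V) : DefinableInC.{u, v} k G := by
  obtain ⟨φ, hφ, h⟩ := exists_defining_sentence.{u, v} hL hk G
    (fun c : Empty => c.elim) ∅
  refine ⟨φ, hφ, fun W _ _ H => ?_⟩
  refine (h W H (fun c => c.elim) fun c => c.elim).trans ⟨?_, ?_⟩
  · rintro ⟨e, he, -⟩
    exact ⟨⟨e, fun {x y} => (he x y).symm⟩⟩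
  · rintro ⟨e⟩
    exact ⟨e.toEquiv, fun x y => e.map_adj_iff.symm, fun c => c.elim⟩

theorem definableInCColored [Fintype V] [Nonempty V] {L : ℕ} (hL : 0 < L)
    (hk : numVars L (Fintype.card V) ≤ k) (G : SimpleGraph V) (χ : V → C) :
    DefinableInCColored.{u, v, w} k G χ := by
  classical
  let D : Finset C := Finset.univ.image χ
  obtain ⟨φ, hφ, h⟩ := exists_defining_sentence.{u, v, w} hL hk G (fun c => {x | χ x = c}) D
  have hk0 : 0 < k := (numVars_pos _ _).trans_le hk
  let i : Fin k := ⟨0, hk0⟩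
  -- This sentence excludes colors not used by `χ`, which the sentence `φ` cannot control.
  let ψ : CFormula C k := .all i (.neg (.conj (D.toList.map fun c => .neg (.color c i))))
  have hψ : ∀ {W : Type v} (H : SimpleGraph W) (η : W → C) (a : Fin k → W),
      ψ.Realize H (fun c => {x | η x = c}) a ↔ ∀ x, η x ∈ D := by
    intro W H η a
    simp only [ψ, CFormula.Realize, CFormula.realize_neg, CFormula.realize_conj]
    refine forall_congr' fun x => ?_
    simp [CFormula.Realize]
  have hψs : ψ.IsSentence := by
    have : ∀ l : List C, (CFormula.conj (l.map fun c => .neg (.color c i)) :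
        CFormula C k).freeVars ⊆ {i} := by
      intro l
      induction l with
      | nil => simp [CFormula.conj, CFormula.neg, CFormula.freeVars]
      | cons c l ih =>
        simp only [List.map_cons, CFormula.conj, CFormula.neg, CFormula.freeVars,
          Finset.union_empty] at ih ⊢
        exact Finset.union_subset (Finset.Subset.refl _) ih
    have h0 := this D.toList
    rw [CFormula.IsSentence]
    simp only [ψ, CFormula.freeVars, CFormula.neg, Finset.union_empty]
    rw [Finset.erase_eq_empty_iff, ← Finset.subset_singleton_iff]
    exact h0
  refine ⟨.conj [ψ, φ], CFormula.isSentence_conj (by simp [hψs, hφ]), fun W _ _ H η => ?_⟩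
  have hiff : CFormula.ModelsColored H η (.conj [ψ, φ]) ↔
      (∀ x, η x ∈ D) ∧ ∀ a, φ.Realize H (fun c => {x | η x = c}) a := by
    simp only [CFormula.ModelsColored, CFormula.realize_conj, List.mem_cons, List.not_mem_nil,
      or_false, forall_eq_or_imp, forall_eq, hψ, forall_and, forall_const]
  have hD : (∀ x, η x ∈ D) → ∀ c ∉ D, {x | η x = c} = ∅ := fun hη c hc =>
    Set.eq_empty_of_forall_notMem fun x hx => hc ((show η x = c from hx) ▸ hη x)
  rw [hiff]
  constructor
  · rintro ⟨hη, hφH⟩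
    obtain ⟨e, he1, he2⟩ := (h W H _ (hD hη)).1 hφH
    exact ⟨⟨e, fun {x y} => (he1 x y).symm⟩, fun x => (he2 (η x) x).1 rfl⟩
  · rintro ⟨e, he⟩
    have hη : ∀ x, η x ∈ D := fun x => by simp [D, ← he x]
    refine ⟨hη, (h W H _ (hD hη)).2 ⟨e.toEquiv, fun x y => e.map_adj_iff.symm, fun c x => ?_⟩⟩
    change η x = c ↔ χ (e x) = c
    rw [he]

end Definability

/-! ### Asymptotics -/

/-- The least number of variables given by a parameter. -/
noncomputable def minVars (n : ℕ) : ℕ := sInf {m | ∃ L, 0 < L ∧ numVars L n = m}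

lemma exists_numVars_eq (n : ℕ) : ∃ L, 0 < L ∧ numVars L n = minVars n :=
  Nat.sInf_mem (s := {m | ∃ L, 0 < L ∧ numVars L n = m}) ⟨_, 1, one_pos, rfl⟩

lemma minVars_le {L : ℕ} (hL : 0 < L) (n : ℕ) : minVars n ≤ numVars L n :=
  Nat.sInf_le ⟨L, hL, rfl⟩

lemma numVars_bounds {L : ℕ} (hL : 0 < L) (n : ℕ) : (n : ℝ) / 4 ≤ numVars L n ∧
    (numVars L n : ℝ) ≤ n / 4 + n * (3 / (4 * L)) + (3 * (18 * L + 1) ^ 12 + 4) := by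
  have hL' : (0 : ℝ) < L := by exact_mod_cast hL
  have e : ((n * (L + 3) : ℕ) : ℝ) / ((4 * L : ℕ) : ℝ) = n / 4 + n * (3 / (4 * L)) := by
    push_cast
    field_simp
  have h1 : ((n * (L + 3) / (4 * L) : ℕ) : ℝ) ≤ n / 4 + n * (3 / (4 * L)) := by
    rw [← e]; exact Nat.cast_div_le
  have h2 : (n : ℝ) / 4 + n * (3 / (4 * L)) < ((n * (L + 3) / (4 * L) : ℕ) : ℝ) + 1 := by
    rw [← e, div_lt_iff₀ (by positivity)]
    have := Nat.lt_mul_div_succ (n * (L + 3)) (b := 4 * L) (by omega)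
    rw [mul_comm (4 * L)] at this
    exact_mod_cast this
  have h3 : (0 : ℝ) ≤ n * (3 / (4 * L)) := by positivity
  have h4 : (0 : ℝ) ≤ (18 * L + 1) ^ 12 := by positivity
  unfold numVars
  push_cast at h1 h2 ⊢
  constructor <;> linarith

lemma minVars_isLittleO : (fun n : ℕ => (minVars n : ℝ) - (n : ℝ) / 4) =o[Filter.atTop]
    (fun n : ℕ => (n : ℝ)) := by
  rw [Asymptotics.isLittleO_iff]
  intro ε hε
  -- This makes the relative excess `3 / (4 * L)` at most `ε / 2`; the constant depending on `L` is
  -- absorbed by the other `ε / 2` for large `n`.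
  obtain ⟨L, hL⟩ := exists_nat_gt (2 / ε)
  have hL' : (0 : ℝ) < L := lt_trans (by positivity) hL
  have hL0 : 0 < L := by exact_mod_cast hL'
  obtain ⟨m, hm⟩ := exists_nat_gt ((3 * (18 * L + 1) ^ 12 + 4) / (ε / 2))
  filter_upwards [Filter.eventually_ge_atTop m] with n hn
  have hn' : (m : ℝ) ≤ n := by exact_mod_cast hn
  have hc : (3 * (18 * L + 1) ^ 12 + 4 : ℝ) ≤ n * (ε / 2) := by
    rw [← div_le_iff₀ (by positivity)]
    linarith
  have hεL : (3 : ℝ) / (4 * L) ≤ ε / 2 := by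
    rw [div_le_iff₀ (by positivity)]
    rw [div_lt_iff₀ hε] at hL
    linarith
  have h1 := (numVars_bounds hL0 n).2
  have h2 : (minVars n : ℝ) ≤ numVars L n := by exact_mod_cast minVars_le hL0 n
  have h3 : (n : ℝ) / 4 ≤ minVars n := by
    obtain ⟨L', hL', h⟩ := exists_numVars_eq n
    rw [← h]
    exact (numVars_bounds hL' n).1
  have h4 : (n : ℝ) * (3 / (4 * L)) ≤ n * (ε / 2) := by gcongr
  rw [Real.norm_of_nonneg (by linarith), Real.norm_of_nonneg (by positivity)]
  linarith

theorem corollary2 :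
    ∃ k : ℕ → ℕ,
      (fun n : ℕ => (k n : ℝ) - (n : ℝ) / 4) =o[Filter.atTop] (fun n : ℕ => (n : ℝ)) ∧
      (∀ (V : Type u) [Fintype V] [Nonempty V] (G : SimpleGraph V),
        DefinableInC.{u, v} (k (Fintype.card V)) G) ∧
      (∀ (V : Type u) [Fintype V] [Nonempty V] (C : Type w) (G : SimpleGraph V) (χ : V → C),
        DefinableInCColored.{u, v, w} (k (Fintype.card V)) G χ) := by
  refine ⟨minVars, minVars_isLittleO, fun V _ _ G => ?_, fun V _ _ C G χ => ?_⟩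
  · obtain ⟨L, hL, h⟩ := exists_numVars_eq (Fintype.card V)
    exact definableInC hL h.le G
  · obtain ⟨L, hL, h⟩ := exists_numVars_eq (Fintype.card V)
    exact definableInCColored hL h.le G χ
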